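/- Let $N$ be a positive integer. For $a\ge 0$ let $NH_a$ be the nilHecke algebra: the $\mathbb{Q}$-algebra with generators $\xi_i$ ($1\le i\le a$) and $\partial_j$ ($1\le j\le a-1$) and relations $$\xi_i\xi_j=\xi_j\xi_i,\qquad \partial_i\xi_j=\xi_j\partial_i\ \ (j\ne i,i+1),\qquad \partial_i\partial_j=\partial_j\partial_i\ \ (|i-j|>1),$$ $$\partial_i^2=0,\qquad \partial_i\partial_{i+1}\partial_i=\partial_{i+1}\partial_i\partial_{i+1},\qquad \xi_i\partial_i-\partial_i\xi_{i+1}=1,\qquad \partial_i\xi_i-\xi_{i+1}\partial_i=1,$$ graded by $\deg\xi_i=2$, $\deg\partial_i=-2$. Let $NH_a^N=NH_a/(NH_a\,\xi_1^N\,NH_a)$ be its cyclotomic quotient with the induced grading ($NH_0^N=NH_0=\mathbb{Q}$). Let $NH_a^N\text{-pmod}$ be the category of $\mathbb{Z}$-graded finitely generated projective left $NH_a^N$-modules and degree-preserving homomorphisms, and let $K_0(NH_a^N\text{-pmod})$ be its split Grothendieck group: the $\mathbb{Z}[q,q^{-1}]$-module generated by symbols $[M]$, one for each object $M$, with relations $[M]=[M_1]+[M_2]$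 whenever $M\cong M_1\oplus M_2$, and $[M\{t\}]=q^t[M]$ for $t\in\mathbb{Z}$, where $M\{t\}$ is $M$ with its grading shifted up by $t$. Let $V^N$ be the irreducible $(N+1)$-dimensional highest weight representation of $U_q(\mathfrak{sl}_2)$ over $\mathbb{Q}(q)$: it has a basis $v_0,\dots,v_N$ with $Kv_k=q^{N-2k}v_k$, $Ev_k=[N-k+1]v_{k-1}$, $Fv_k=[k+1]v_{k+1}$, where $v_{-1}=v_{N+1}=0$ and $[n]=\frac{q^n-q^{-n}}{q-q^{-1}}$. Then there is an isomorphism of $\mathbb{Q}(q)$-vector spaces $$\bigoplus_{a\ge 0} K_0(NH_a^N\text{-pmod})\otimes_{\mathbb{Z}[q,q^{-1}]}\mathbb{Q}(q)\;\cong\;V^N .$$ -/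

import Mathlib

noncomputable section

open scoped DirectSum TensorProduct

namespace CycNilHecke

/-! ### The nilHecke algebra and its cyclotomic quotients, as graded algebras over `ℚ` -/

/-- Generators of the nilHecke algebra on `a` strands. Indices start at `0`: `xi i` is the dot
`ξ_{i+1}` (`0 ≤ i < a`) and `del i` is the crossing `∂_{i+1}` (`0 ≤ i < a - 1`). -/
inductive Gen (a : ℕ) : Type
  | xi (i : ℕ) (h : i < a) : Gen a
  | del (i : ℕ) (h : i + 1 < a) : Gen a

/-- The degree of a generator: `deg ξ_i = 2`, `deg ∂_i = -2`. -/
def Gen.deg {a : ℕ} : Gen a → ℤ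
  | .xi _ _ => 2
  | .del _ _ => -2

/-- `ξ_{i+1}` in the free algebra. -/
abbrev fxi {a : ℕ} (i : ℕ) (h : i < a) : FreeAlgebra ℚ (Gen a) := FreeAlgebra.ι ℚ (Gen.xi i h)

/-- `∂_{i+1}` in the free algebra. -/
abbrev fdel {a : ℕ} (i : ℕ) (h : i + 1 < a) : FreeAlgebra ℚ (Gen a) :=
  FreeAlgebra.ι ℚ (Gen.del i h)

/-- The defining relations of the nilHecke algebra. -/
inductive Rel (a : ℕ) : FreeAlgebra ℚ (Gen a) → FreeAlgebra ℚ (Gen a) → Prop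
  | xi_xi (i j : ℕ) (hi : i < a) (hj : j < a) :
      Rel a (fxi i hi * fxi j hj) (fxi j hj * fxi i hi)
  | del_xi (i j : ℕ) (hi : i + 1 < a) (hj : j < a) (h₁ : j ≠ i) (h₂ : j ≠ i + 1) :
      Rel a (fdel i hi * fxi j hj) (fxi j hj * fdel i hi)
  | del_del (i j : ℕ) (hi : i + 1 < a) (hj : j + 1 < a) (hij : i + 1 < j) :
      Rel a (fdel i hi * fdel j hj) (fdel j hj * fdel i hi)
  | del_sq (i : ℕ) (hi : i + 1 < a) : Rel a (fdel i hi * fdel i hi) 0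
  | braid (i : ℕ) (hi : i + 1 + 1 < a) :
      Rel a (fdel i (Nat.lt_of_succ_lt hi) * fdel (i + 1) hi * fdel i (Nat.lt_of_succ_lt hi))
        (fdel (i + 1) hi * fdel i (Nat.lt_of_succ_lt hi) * fdel (i + 1) hi)
  | xi_del (i : ℕ) (hi : i + 1 < a) :
      Rel a (fxi i (Nat.lt_of_succ_lt hi) * fdel i hi) (fdel i hi * fxi (i + 1) hi + 1)
  | del_xi_self (i : ℕ) (hi : i + 1 < a) :
      Rel a (fdel i hi * fxi i (Nat.lt_of_succ_lt hi)) (fxi (i + 1) hi * fdel i hi + 1)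

/-- The nilHecke algebra `NH_a`. -/
abbrev NH (a : ℕ) : Type := RingQuot (Rel a)

/-- The image of a generator in `NH_a`. -/
def NH.gen {a : ℕ} (g : Gen a) : NH a := RingQuot.mkAlgHom ℚ (Rel a) (FreeAlgebra.ι ℚ g)

/-- The cyclotomic relation `ξ_1 ^ N = 0` (there is no such relation if `a = 0`). -/
inductive CycRel (a N : ℕ) : NH a → NH a → Prop
  | xi_pow (h : 0 < a) : CycRel a N (NH.gen (Gen.xi 0 h) ^ N) 0

/-- The cyclotomic quotient `NH_a^N`, the quotient of `NH_a` by the two-sided ideal generated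
by `ξ_1 ^ N`. -/
abbrev CycNH (a N : ℕ) : Type := RingQuot (CycRel a N)

/-- The image of a generator in `NH_a^N`. -/
def CycNH.gen {a : ℕ} (N : ℕ) (g : Gen a) : CycNH a N :=
  RingQuot.mkAlgHom ℚ (CycRel a N) (NH.gen g)

/-- The homogeneous part of degree `d` of `NH_a^N`: the span of all words in the generators of total
degree `d`. -/
def CycNH.grading (a N : ℕ) (d : ℤ) : Submodule ℚ (CycNH a N) :=
  Submodule.span ℚ
    {x | ∃ w : List (Gen a), (w.map Gen.deg).sum = d ∧ x = (w.map (CycNH.gen N)).prod}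

/-! The words do define a grading of the algebra `NH_a^N`. -/

lemma CycNH.gen_mem {a : ℕ} (N : ℕ) (g : Gen a) : CycNH.gen N g ∈ CycNH.grading a N g.deg :=
  Submodule.subset_span ⟨[g], by simp, by simp⟩

instance CycNH.gradedMonoid (a N : ℕ) : SetLike.GradedMonoid (CycNH.grading a N) where
  one_mem := Submodule.subset_span ⟨[], by simp, by simp⟩
  mul_mem := by
    intro i j x y hx hy
    have h := Submodule.mul_mem_mul hx hy
    rw [CycNH.grading, CycNH.grading, Submodule.span_mul_span] at h
    refine Submodule.span_mono ?_ h
    rintro _ ⟨_, ⟨w, hw, rfl⟩, _, ⟨w', hw', rfl⟩, rfl⟩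
    exact ⟨w ++ w', by simp [hw, hw'], by simp⟩

/-- A generator as an element of the external direct sum of the homogeneous parts. -/
def CycNH.extGen {a : ℕ} (N : ℕ) (g : Gen a) : ⨁ d, CycNH.grading a N d :=
  DirectSum.of (fun d => CycNH.grading a N d) g.deg ⟨CycNH.gen N g, CycNH.gen_mem N g⟩

lemma of_congr {a N : ℕ} {i j : ℤ} {x : CycNH.grading a N i} {y : CycNH.grading a N j}
    (hij : i = j) (h : (x : CycNH a N) = y) :
    DirectSum.of (fun d => CycNH.grading a N d) i x =
      DirectSum.of (fun d => CycNH.grading a N d) j y := by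
  subst hij
  rw [Subtype.ext h]

lemma of_congr_add_one {a N : ℕ} {i j : ℤ} {x : CycNH.grading a N i} {y : CycNH.grading a N j}
    (hi : i = 0) (hj : j = 0) (h : (x : CycNH a N) = y + 1) :
    DirectSum.of (fun d => CycNH.grading a N d) i x =
      DirectSum.of (fun d => CycNH.grading a N d) j y + 1 := by
  subst hi hj
  rw [DirectSum.one_def, ← map_add]
  exact of_congr rfl h

lemma CycNH.rel_gen {a : ℕ} (N : ℕ) {x y : FreeAlgebra ℚ (Gen a)} (h : Rel a x y) :
    FreeAlgebra.lift ℚ (CycNH.gen N) x = FreeAlgebra.lift ℚ (CycNH.gen N) y := by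
  have e : FreeAlgebra.lift ℚ (CycNH.gen (a := a) N) =
      (RingQuot.mkAlgHom ℚ (CycRel a N)).comp (RingQuot.mkAlgHom ℚ (Rel a)) := by
    ext g
    simp [CycNH.gen, NH.gen]
  rw [e]
  simp [RingQuot.mkAlgHom_rel ℚ h]

lemma CycNH.rel_extGen {a : ℕ} (N : ℕ) {x y : FreeAlgebra ℚ (Gen a)} (h : Rel a x y) :
    FreeAlgebra.lift ℚ (CycNH.extGen N) x = FreeAlgebra.lift ℚ (CycNH.extGen N) y := by
  have key := CycNH.rel_gen N h
  cases h with
  | xi_xi i j hi hj =>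
    simp only [map_mul, FreeAlgebra.lift_ι_apply, CycNH.extGen, DirectSum.of_mul_of] at key ⊢
    exact of_congr (by simp [Gen.deg]) key
  | del_xi i j hi hj h₁ h₂ =>
    simp only [map_mul, FreeAlgebra.lift_ι_apply, CycNH.extGen, DirectSum.of_mul_of] at key ⊢
    exact of_congr (by simp [Gen.deg]) key
  | del_del i j hi hj hij =>
    simp only [map_mul, FreeAlgebra.lift_ι_apply, CycNH.extGen, DirectSum.of_mul_of] at key ⊢
    exact of_congr (by simp [Gen.deg]) key
  | del_sq i hi =>
    simp only [map_mul, map_zero, FreeAlgebra.lift_ι_apply, CycNH.extGen,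
      DirectSum.of_mul_of] at key ⊢
    rw [← map_zero (DirectSum.of (fun d => CycNH.grading a N d) (-2 + -2))]
    exact of_congr (by simp [Gen.deg]) key
  | braid i hi =>
    simp only [map_mul, FreeAlgebra.lift_ι_apply, CycNH.extGen, DirectSum.of_mul_of] at key ⊢
    exact of_congr (by simp [Gen.deg]) key
  | xi_del i hi =>
    simp only [map_mul, map_add, map_one, FreeAlgebra.lift_ι_apply, CycNH.extGen,
      DirectSum.of_mul_of] at key ⊢
    exact of_congr_add_one (by simp [Gen.deg]) (by simp [Gen.deg]) key
  | del_xi_self i hi =>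
    simp only [map_mul, map_add, map_one, FreeAlgebra.lift_ι_apply, CycNH.extGen,
      DirectSum.of_mul_of] at key ⊢
    exact of_congr_add_one (by simp [Gen.deg]) (by simp [Gen.deg]) key

/-- The decomposition on the level of `NH_a`. -/
def NH.decompose (a N : ℕ) : NH a →ₐ[ℚ] ⨁ d, CycNH.grading a N d :=
  RingQuot.liftAlgHom ℚ ⟨FreeAlgebra.lift ℚ (CycNH.extGen N), fun _ _ h => CycNH.rel_extGen N h⟩

lemma NH.decompose_gen {a : ℕ} (N : ℕ) (g : Gen a) :
    NH.decompose a N (NH.gen g) = CycNH.extGen N g := by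
  simp [NH.decompose, NH.gen]

/-- The decomposition of elements of `NH_a^N` into homogeneous components. -/
def CycNH.decompose (a N : ℕ) : CycNH a N →ₐ[ℚ] ⨁ d, CycNH.grading a N d :=
  RingQuot.liftAlgHom ℚ ⟨NH.decompose a N, by
    intro x y h
    cases h with
    | xi_pow h =>
      rw [map_pow, map_zero, NH.decompose_gen, CycNH.extGen, DirectSum.ofPow,
        ← map_zero (DirectSum.of (fun d => CycNH.grading a N d) (N • Gen.deg (Gen.xi 0 h)))]
      refine of_congr rfl ?_
      have := RingQuot.mkAlgHom_rel ℚ (CycRel.xi_pow (N := N) h)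
      simpa [CycNH.gen] using this⟩

lemma CycNH.decompose_gen {a : ℕ} (N : ℕ) (g : Gen a) :
    CycNH.decompose a N (CycNH.gen N g) = CycNH.extGen N g := by
  simp [CycNH.decompose, CycNH.gen, NH.decompose_gen]

lemma CycNH.decompose_word {a : ℕ} (N : ℕ) (w : List (Gen a)) :
    CycNH.decompose a N (w.map (CycNH.gen N)).prod =
      DirectSum.of (fun d => CycNH.grading a N d) (w.map Gen.deg).sum
        ⟨(w.map (CycNH.gen N)).prod, Submodule.subset_span ⟨w, rfl, rfl⟩⟩ := by
  induction w with
  | nil =>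
    simp only [List.map_nil, List.prod_nil, map_one]
    exact DirectSum.one_def _
  | cons g w ih =>
    have : (List.map (CycNH.gen N) (g :: w)).prod =
        CycNH.gen N g * (List.map (CycNH.gen N) w).prod := by simp
    refine (congrArg (CycNH.decompose a N) this).trans ?_
    rw [map_mul, ih, CycNH.decompose_gen, CycNH.extGen, DirectSum.of_mul_of]
    exact of_congr (by simp) this.symm

/-- `NH_a^N` is a `ℤ`-graded `ℚ`-algebra. -/
instance CycNH.gradedAlgebra (a N : ℕ) : GradedAlgebra (CycNH.grading a N) :=
  GradedAlgebra.ofAlgHom _ (CycNH.decompose a N)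
    (by
      ext g
      have := CycNH.decompose_gen N g
      simp only [CycNH.gen, NH.gen] at this
      simp [this, CycNH.extGen, CycNH.gen, NH.gen])
    (by
      rintro d ⟨x, hx⟩
      change CycNH.decompose a N x = _
      induction hx using Submodule.span_induction with
      | mem x h =>
        obtain ⟨w, hw, rfl⟩ := h
        rw [CycNH.decompose_word]
        exact of_congr hw rfl
      | zero =>
        rw [map_zero, ← map_zero (DirectSum.of (fun d => CycNH.grading a N d) d)]
        exact of_congr rfl rfl
      | add x y hx hy ihx ihy =>
        rw [map_add, ihx, ihy, ← map_add]
        exact of_congr rfl rfl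
      | smul c x hx ih =>
        rw [map_smul, ih]
        exact (DirectSum.lof ℚ ℤ (fun d => CycNH.grading a N d) d).map_smul c ⟨x, hx⟩ |>.symm)

/-! ### The split Grothendieck group of graded finitely generated projective modules -/

section Grothendieck

variable {A : Type} [Ring A] [Algebra ℚ A] (𝒜 : ℤ → Submodule ℚ A) [GradedAlgebra 𝒜]

lemma isInternal_comp_equiv {M : Type} [AddCommGroup M] (D : ℤ → AddSubgroup M)
    (h : DirectSum.IsInternal D) (f : ℤ ≃ ℤ) : DirectSum.IsInternal fun i => D (f i) := by
  obtain ⟨g, rfl⟩ : ∃ g : ℤ ≃ ℤ, f = g.symm := ⟨f.symm, rfl⟩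
  let e := DirectSum.lequivCongrLeft ℤ (M := fun i => D i) g
  have he : (DirectSum.coeAddMonoidHom D).comp e.symm.toLinearMap.toAddMonoidHom =
      DirectSum.coeAddMonoidHom fun i => D (g.symm i) := by
    ext i x
    have := DirectSum.lequivCongrLeft_symm_lof ℤ (M := fun i => D i) (h := g) (k := i) (x := x)
    simp only [DirectSum.lof_eq_of] at this
    simp [e, this]
  have h' : Function.Bijective (DirectSum.coeAddMonoidHom D) := h
  have h'' := h'.comp e.symm.bijective
  change Function.Bijective
    ((DirectSum.coeAddMonoidHom D).comp e.symm.toLinearMap.toAddMonoidHom) at h''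
  rw [he] at h''
  exact h''

/-- A `ℤ`-graded finitely generated projective left module over the graded algebra `(A, 𝒜)`. -/
structure GrProj : Type 1 where
  /-- the underlying module -/
  carrier : Type
  [addCommGroup : AddCommGroup carrier]
  [module : Module A carrier]
  [finite : Module.Finite A carrier]
  [projective : Module.Projective A carrier]
  /-- the homogeneous parts -/
  deg : ℤ → AddSubgroup carrier
  isInternal : DirectSum.IsInternal deg
  smul_mem : ∀ {i j : ℤ} {x : A} {m : carrier}, x ∈ 𝒜 i → m ∈ deg j → x • m ∈ deg (i + j)

attribute [instance] GrProj.addCommGroup GrProj.module GrProj.finite GrProj.projective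

variable {𝒜}

/-- The grading shift `M{t}`, shifting the grading up by `t`: `M{t}_i = M_{i - t}`. -/
def GrProj.shift (M : GrProj 𝒜) (t : ℤ) : GrProj 𝒜 where
  carrier := M.carrier
  deg i := M.deg (i - t)
  isInternal :=
    isInternal_comp_equiv M.deg M.isInternal (Equiv.subRight t)
  smul_mem {i j x m} hx hm := by
    rw [add_sub_assoc]
    exact M.smul_mem hx hm

/-- `M ≅ M₁ ⊕ M₂` as graded modules, by a degree preserving isomorphism. -/
def GrProj.IsDirectSum (M M₁ M₂ : GrProj 𝒜) : Prop :=
  ∃ e : M.carrier ≃ₗ[A] M₁.carrier × M₂.carrier,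
    ∀ (i : ℤ) (m : M.carrier), m ∈ M.deg i ↔ (e m).1 ∈ M₁.deg i ∧ (e m).2 ∈ M₂.deg i

variable (𝒜)

/-- The relations `[M] = [M₁] + [M₂]` whenever `M ≅ M₁ ⊕ M₂` and `[M{t}] = q ^ t [M]` in the free
`ℤ[q, q⁻¹]`-module on all graded finitely generated projective modules. The first one identifies
isomorphic modules, since `M ≅ M'` gives `M ≅ M' ⊕ 0`. -/
def K0Relations : Set (GrProj 𝒜 →₀ LaurentPolynomial ℤ) :=
  {z | ∃ M M₁ M₂ : GrProj 𝒜, M.IsDirectSum M₁ M₂ ∧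
      z = Finsupp.single M 1 - (Finsupp.single M₁ 1 + Finsupp.single M₂ 1)} ∪
  {z | ∃ (M : GrProj 𝒜) (t : ℤ),
      z = Finsupp.single (M.shift t) 1 - Finsupp.single M (LaurentPolynomial.T t)}

/-- The split Grothendieck group `K₀` of the category of graded finitely generated projective
modules and degree preserving maps, as a module over `ℤ[q, q⁻¹]`. -/
abbrev K0 : Type 1 :=
  (GrProj 𝒜 →₀ LaurentPolynomial ℤ) ⧸ Submodule.span (LaurentPolynomial ℤ) (K0Relations 𝒜)

end Grothendieck

/-! ### Quantum `sl₂` and its irreducible representations -/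

/-- The field `ℚ(q)`. -/
abbrev Qq : Type := RatFunc ℚ

/-- The indeterminate `q`. -/
abbrev q : Qq := RatFunc.X

/-- `ℚ(q)` is an algebra over `ℤ[q, q⁻¹]` by the inclusion. -/
instance laurentAlgebra : Algebra (LaurentPolynomial ℤ) Qq :=
  (LaurentPolynomial.eval₂ (Int.castRingHom Qq) (Units.mk0 q RatFunc.X_ne_zero)).toAlgebra

/-- The quantum integer `[n] = (q^n - q^{-n}) / (q - q^{-1})`. -/
def qInt (n : ℤ) : Qq := (q ^ n - q ^ (-n)) / (q - q⁻¹)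

/-- Generators of `U_q(sl₂)`. -/
inductive UqGen : Type
  | E | F | K | Kinv

/-- Defining relations of `U_q(sl₂)`. -/
inductive UqRel : FreeAlgebra Qq UqGen → FreeAlgebra Qq UqGen → Prop
  | K_Kinv : UqRel (FreeAlgebra.ι Qq .K * FreeAlgebra.ι Qq .Kinv) 1
  | Kinv_K : UqRel (FreeAlgebra.ι Qq .Kinv * FreeAlgebra.ι Qq .K) 1
  | K_E : UqRel (FreeAlgebra.ι Qq .K * FreeAlgebra.ι Qq .E)
      (q ^ 2 • (FreeAlgebra.ι Qq .E * FreeAlgebra.ι Qq .K))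
  | K_F : UqRel (FreeAlgebra.ι Qq .K * FreeAlgebra.ι Qq .F)
      (q ^ (-2 : ℤ) • (FreeAlgebra.ι Qq .F * FreeAlgebra.ι Qq .K))
  | E_F : UqRel (FreeAlgebra.ι Qq .E * FreeAlgebra.ι Qq .F -
        FreeAlgebra.ι Qq .F * FreeAlgebra.ι Qq .E)
      ((q - q⁻¹)⁻¹ • (FreeAlgebra.ι Qq .K - FreeAlgebra.ι Qq .Kinv))

/-- The quantum group `U_q(sl₂)` over `ℚ(q)`. -/
abbrev Uq : Type := RingQuot UqRel

/-- The underlying `ℚ(q)`-vector space of the irreducible representation `V^N`, with coordinates in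
the basis `v_k = F^k v / [k]!` (`0 ≤ k ≤ N`), `v` a highest weight vector. -/
abbrev VN (N : ℕ) : Type := Fin (N + 1) → Qq

namespace VN

variable (N : ℕ)

/-- The basis vector `v_k` for `0 ≤ k ≤ N`, and `0` for any other integer `k`. -/
def v (k : ℤ) : VN N := fun j => if (j : ℤ) = k then 1 else 0

/-- The linear map that takes `v_k` to `f k`. -/
def ofBasis (f : ℤ → VN N) : Module.End Qq (VN N) :=
  (Pi.basisFun Qq (Fin (N + 1))).constr Qq fun k => f k

/-- The action of the generators: `E v_k = [N - k + 1] v_{k-1}`, `F v_k = [k + 1] v_{k+1}`,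
`K v_k = q ^ (N - 2 k) v_k`. -/
def act : UqGen → Module.End Qq (VN N)
  | .E => ofBasis N fun k => qInt (N - k + 1) • v N (k - 1)
  | .F => ofBasis N fun k => qInt (k + 1) • v N (k + 1)
  | .K => ofBasis N fun k => q ^ (N - 2 * k : ℤ) • v N k
  | .Kinv => ofBasis N fun k => q ^ (-(N - 2 * k : ℤ)) • v N k

lemma v_eq_zero {k : ℤ} (hk : k < 0 ∨ N < k) : v N k = 0 := by
  ext j
  have := j.2
  simp only [v, Pi.zero_apply, ite_eq_right_iff, one_ne_zero, imp_false]
  omega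

lemma ofBasis_v (f : ℤ → VN N) (k : ℤ) (h : k < 0 ∨ N < k → f k = 0) :
    ofBasis N f (v N k) = f k := by
  by_cases hk : k < 0 ∨ N < k
  · rw [v_eq_zero N hk, h hk, map_zero]
  · push Not at hk
    obtain ⟨n, rfl⟩ := Int.eq_ofNat_of_zero_le hk.1
    have hn : n < N + 1 := by omega
    have : v N n = Pi.basisFun Qq (Fin (N + 1)) ⟨n, hn⟩ := by
      ext j
      simp [v, Pi.single_apply, Fin.ext_iff]
    rw [this, ofBasis, Module.Basis.constr_basis]

lemma qInt_zero : qInt 0 = 0 := by simp [qInt]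

lemma act_E (k : ℤ) (hk : k ≤ N + 1) :
    act N .E (v N k) = qInt (N - k + 1) • v N (k - 1) := by
  refine ofBasis_v N (fun k => qInt (N - k + 1) • v N (k - 1)) k ?_
  rintro (h | h)
  · simp [v_eq_zero N (k := k - 1) (by omega)]
  · obtain rfl : k = N + 1 := by omega
    simp [qInt_zero]

lemma act_F (k : ℤ) (hk : -1 ≤ k) : act N .F (v N k) = qInt (k + 1) • v N (k + 1) := by
  refine ofBasis_v N (fun k => qInt (k + 1) • v N (k + 1)) k ?_
  rintro (h | h)
  · obtain rfl : k = -1 := by omega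
    simp [qInt_zero]
  · simp [v_eq_zero N (k := k + 1) (by omega)]

lemma act_K (k : ℤ) : act N .K (v N k) = q ^ (N - 2 * k : ℤ) • v N k :=
  ofBasis_v N (fun k => q ^ (N - 2 * k : ℤ) • v N k) k fun h => by simp [v_eq_zero N h]

lemma act_Kinv (k : ℤ) : act N .Kinv (v N k) = q ^ (-(N - 2 * k : ℤ)) • v N k :=
  ofBasis_v N (fun k => q ^ (-(N - 2 * k : ℤ)) • v N k) k fun h => by simp [v_eq_zero N h]

lemma ext_v {f g : Module.End Qq (VN N)}
    (h : ∀ k : ℤ, 0 ≤ k → k ≤ N → f (v N k) = g (v N k)) : f = g := by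
  refine (Pi.basisFun Qq (Fin (N + 1))).ext fun i => ?_
  have : v N i = Pi.basisFun Qq (Fin (N + 1)) i := by
    ext j
    simp [v, Pi.single_apply, Fin.ext_iff]
  rw [← this]
  exact h i (by omega) (by have := i.2; omega)

lemma q_pow_ne_one {n : ℕ} (hn : n ≠ 0) : q ^ n ≠ 1 := by
  intro h
  have h' : (Polynomial.X ^ n : Polynomial ℚ) = 1 := by
    apply RatFunc.algebraMap_injective ℚ
    simpa [RatFunc.algebraMap_X] using h
  have := congrArg Polynomial.natDegree h'
  simp at this
  exact hn this

lemma q_sub_ne_zero : q - q⁻¹ ≠ 0 := by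
  intro h
  refine q_pow_ne_one (n := 2) (by norm_num) ?_
  have h0 : q ≠ 0 := RatFunc.X_ne_zero
  field_simp at h
  linear_combination h

lemma qInt_ne_zero {n : ℤ} (hn : 0 < n) : qInt n ≠ 0 := by
  obtain ⟨m, rfl⟩ := Int.eq_ofNat_of_zero_le hn.le
  have h0 : q ≠ 0 := RatFunc.X_ne_zero
  refine div_ne_zero (fun h => ?_) q_sub_ne_zero
  refine q_pow_ne_one (n := 2 * m) (by omega) ?_
  rw [zpow_neg, zpow_natCast] at h
  have := pow_ne_zero m h0
  field_simp at h
  rw [mul_comm, pow_mul]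
  linear_combination h

/-- The representation of `U_q(sl₂)` on `V^N`. -/
def rep : Uq →ₐ[Qq] Module.End Qq (VN N) :=
  RingQuot.liftAlgHom Qq ⟨FreeAlgebra.lift Qq (act N), by
    have h0 : q ≠ 0 := RatFunc.X_ne_zero
    intro x y h
    cases h with
    | K_Kinv =>
      refine ext_v N fun k _ _ => ?_
      simp [act_K, act_Kinv, smul_smul, ← zpow_add₀ h0]
    | Kinv_K =>
      refine ext_v N fun k _ _ => ?_
      simp [act_K, act_Kinv, smul_smul, ← zpow_add₀ h0]
    | K_E =>
      refine ext_v N fun k _ _ => ?_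
      have e : q ^ (N - 2 * (k - 1) : ℤ) = q ^ 2 * q ^ (N - 2 * k : ℤ) := by
        rw [← zpow_natCast, ← zpow_add₀ h0]
        congr 1
        push_cast
        ring
      simp only [map_mul, map_smul, FreeAlgebra.lift_ι_apply, Module.End.mul_apply,
        LinearMap.smul_apply, act_K, act_E N k (by omega), smul_smul, e]
      congr 1
      ring
    | K_F =>
      refine ext_v N fun k _ _ => ?_
      have e : q ^ (N - 2 * (k + 1) : ℤ) = q ^ (-2 : ℤ) * q ^ (N - 2 * k : ℤ) := by
        rw [← zpow_add₀ h0]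
        congr 1
        ring
      simp only [map_mul, map_smul, FreeAlgebra.lift_ι_apply, Module.End.mul_apply,
        LinearMap.smul_apply, act_K, act_F N k (by omega), smul_smul, e]
      congr 1
      ring
    | E_F =>
      refine ext_v N fun k _ _ => ?_
      simp only [map_mul, map_sub, map_smul, FreeAlgebra.lift_ι_apply, Module.End.mul_apply,
        LinearMap.smul_apply, LinearMap.sub_apply, act_K, act_Kinv, act_F N k (by omega),
        act_E N k (by omega), act_E N (k + 1) (by omega), act_F N (k - 1) (by omega), smul_smul,
        add_sub_cancel_right, sub_add_cancel, ← sub_smul]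
      congr 1
      have h1 := q_sub_ne_zero
      have e1 : (N - (k + 1) + 1 : ℤ) = N - k := by ring
      have h2 : q ^ k ≠ 0 := zpow_ne_zero _ h0
      have h3 : q ^ (N : ℤ) ≠ 0 := zpow_ne_zero _ h0
      rw [e1]
      simp only [qInt, zpow_sub₀ h0, zpow_add₀ h0, zpow_neg, two_mul, zpow_one]
      generalize q ^ k = x at *
      generalize q ^ (N : ℤ) = y at *
      have h4 : q ^ 2 - 1 ≠ 0 := by
        intro h
        apply h1
        field_simp
        linear_combination h
      field_simp
      ring⟩

lemma rep_gen (g : UqGen) :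
    rep N (RingQuot.mkAlgHom Qq UqRel (FreeAlgebra.ι Qq g)) = act N g := by
  simp [rep]

/-- `v_0` is a highest weight vector of weight `N`. -/
theorem rep_highest_weight : v N 0 ≠ 0 ∧ act N .E (v N 0) = 0 ∧
    act N .K (v N 0) = q ^ N • v N 0 := by
  refine ⟨fun h => ?_, ?_, ?_⟩
  · simpa [v] using congrFun h 0
  · rw [act_E N 0 (by omega), v_eq_zero N (by omega), smul_zero]
  · simp [act_K]

/-- `V^N` is an irreducible representation of `U_q(sl₂)`. -/
theorem rep_irreducible (W : Submodule Qq (VN N)) (hW : ∀ u : Uq, ∀ w ∈ W, rep N u w ∈ W) :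
    W = ⊥ ∨ W = ⊤ := by
  have hg : ∀ g, ∀ w ∈ W, act N g w ∈ W := fun g w hw => by
    rw [← rep_gen]
    exact hW _ w hw
  have sum_v : ∀ w : VN N, w = ∑ i : Fin (N + 1), w i • v N i := fun w => by
    ext j
    rw [Finset.sum_apply, Finset.sum_eq_single j]
    · simp [v]
    · intro i _ hi
      have : (j : ℕ) ≠ i := fun h => hi (Fin.ext h.symm)
      simp [v, this]
    · simp
  by_cases hbot : W = ⊥
  · exact Or.inl hbot
  right
  obtain ⟨w, hw, hw0⟩ := W.ne_bot_iff.1 hbot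
  have h0 : ∀ n : ℕ, ∀ w ∈ W, w ≠ 0 → (∀ i : Fin (N + 1), n < (i : ℕ) → w i = 0) → v N 0 ∈ W := by
    intro n
    induction n with
    | zero =>
      intro w hw hw0 h
      have e : w = w 0 • v N 0 := by
        ext j
        rcases eq_or_ne j 0 with rfl | hj
        · simp [v]
        · have : (j : ℕ) ≠ 0 := fun h => hj (Fin.ext h)
          simp [v, this, h j (by omega)]
      have hne : w 0 ≠ 0 := fun h => hw0 (by rw [e, h, zero_smul])
      rw [e] at hw
      exact (W.smul_mem_iff hne).1 hw
    | succ n ih =>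
      intro w hw hw0 h
      by_cases hn : ∃ i : Fin (N + 1), (i : ℕ) = n + 1 ∧ w i ≠ 0
      · obtain ⟨i, hi, hwi⟩ := hn
        have hE : ∀ j : Fin (N + 1), act N .E w j =
            ∑ i : Fin (N + 1), w i * (qInt (N - i + 1) * if (j : ℤ) = i - 1 then 1 else 0) := by
          intro j
          conv_lhs => rw [sum_v w, map_sum, Finset.sum_apply]
          refine Finset.sum_congr rfl fun i _ => ?_
          rw [map_smul, act_E N i (by have := i.2; omega)]
          rfl
        refine ih _ (hg .E w hw) (fun h' => ?_) fun j hj => ?_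
        · have := congrFun h' ⟨n, by omega⟩
          rw [hE, Finset.sum_eq_single i] at this
          · have hq : qInt (N - i + 1) ≠ 0 := qInt_ne_zero (by omega)
            simp [hi, hwi] at this
            simp [hi] at hq
            exact hq this
          · intro k _ hk
            have : (k : ℕ) ≠ i := fun h => hk (Fin.ext h)
            rw [if_neg (by simp only []; omega)]
            simp
          · simp
        · rw [hE]
          refine Finset.sum_eq_zero fun k _ => ?_
          by_cases hk : n + 1 < (k : ℕ)
          · simp [h k hk]
          · rw [if_neg (by omega)]
            simp
      · push Not at hn
        refine ih w hw hw0 fun i hi => ?_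
        rcases Nat.lt_or_ge (n + 1) i with h' | h'
        · exact h i h'
        · exact hn i (by omega)
  have hv : ∀ n : ℕ, v N n ∈ W := by
    intro n
    induction n with
    | zero => exact h0 N w hw hw0 fun i hi => absurd i.2 (by omega)
    | succ n ih =>
      have := hg .F _ ih
      rw [act_F N n (by omega)] at this
      exact_mod_cast (W.smul_mem_iff (qInt_ne_zero (by omega))).1 this
  rw [eq_top_iff]
  intro x _
  rw [sum_v x]
  exact W.sum_mem fun i _ => W.smul_mem _ (hv i)

end VN

end CycNilHecke

end

noncomputable section

namespace CycNilHecke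

/-! ### Identities in rings with a family of elements satisfying the nilHecke relations -/

/-! Only dimensions over ℚ(q) matter. `VN N` has dimension N + 1, so it suffices that K₀ of A =
NH_a^N is free of rank one over ℤ[q, q⁻¹] for a ≤ N and zero for a > N (`CycNH.nonempty_basis`).

The key is e = ξ^δ ∂_{w₀}. Crossings kill ∂_{w₀}, and ∂_{w₀} ξ^δ y = y whenever all crossings kill
y, so e is an idempotent, of degree 0. Moving crossings to the right shows that A ∂_{w₀} consists of
polynomials in the dots times ∂_{w₀}; hence eAe lives in non-negative degrees with degree zero part
ℚe, a graded local ring. Taking commutators with dots strips the crossings off ∂_{w₀} until 1 is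
left, so AeA = A. All this is `CycNH.isConnectedFullIdempotent`. Graded Morita theory, carried out
by hand with a Nakayama argument, then makes every graded finitely generated projective a sum of
shifts of Ae (`K0.exists_mk_eq`). The class [Ae] is torsion-free when A ≠ 0, since its graded
dimension is a nonzero Laurent polynomial. Finite dimensionality of A holds because the dots are
nilpotent, so A ∂_{w₀} is finite-dimensional, and AeA = A spreads this to A.

If a > N, then ξ^δ contains the factor ξ_1^{a-1} = 0, so e = 0 and A = 0. If a ≤ N, then A ≠ 0
because it acts by divided differences on the coinvariant algebra, where ξ_1^a = 0
(`CycNH.nontrivial`). Neither a basis of NH_a nor its description as a matrix algebra is needed. -/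

/-- The families `x` (dots) and `d` (crossings) satisfy the nilHecke relations on `a` strands. -/
structure NilHeckeFamily {B : Type*} [Ring B] (a : ℕ) (x d : ℕ → B) : Prop where
  x_x : ∀ i j, i < a → j < a → Commute (x i) (x j)
  d_x : ∀ i j, i + 1 < a → j < a → j ≠ i → j ≠ i + 1 → Commute (d i) (x j)
  d_d : ∀ i j, i + 1 < a → j + 1 < a → i + 1 < j → Commute (d i) (d j)
  d_sq : ∀ i, i + 1 < a → d i * d i = 0
  braid : ∀ i, i + 1 + 1 < a → d i * d (i + 1) * d i = d (i + 1) * d i * d (i + 1)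
  x_mul_d : ∀ i, i + 1 < a → x i * d i = d i * x (i + 1) + 1
  d_mul_x : ∀ i, i + 1 < a → d i * x i = x (i + 1) * d i + 1

section Words

variable {B : Type*} [Ring B]

/-- `descWord d k m` is `d_{k+m-1} ⋯ d_{k+1} d_k`. -/
def descWord (d : ℕ → B) (k : ℕ) : ℕ → B
  | 0 => 1
  | m + 1 => d (k + m) * descWord d k m

/-- The element `∂_{w₀}` of the nilHecke algebra on `n` strands. -/
def longest (d : ℕ → B) : ℕ → B
  | 0 => 1
  | n + 1 => longest d n * descWord d 0 n

/-- The product `x_0 ⋯ x_{n-1}`. -/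
def prefixProd (x : ℕ → B) : ℕ → B
  | 0 => 1
  | n + 1 => prefixProd x n * x n

/-- The staircase monomial `x_0^{n-1} x_1^{n-2} ⋯ x_{n-2}`. -/
def staircase (x : ℕ → B) : ℕ → B
  | 0 => 1
  | n + 1 => staircase x n * prefixProd x n

lemma descWord_succ_right (d : ℕ → B) (k m : ℕ) :
    descWord d k (m + 1) = descWord d (k + 1) m * d k := by
  induction m with
  | zero => simp [descWord]
  | succ m ih =>
    rw [descWord, ih, descWord, mul_assoc]
    congr 2
    omega

lemma commute_descWord {d : ℕ → B} {z : B} {k m : ℕ} (h : ∀ i, k ≤ i → i < k + m → Commute z (d i)) :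
    Commute z (descWord d k m) := by
  induction m with
  | zero => exact Commute.one_right z
  | succ m ih =>
    exact (h _ (by omega) (by omega)).mul_right (ih fun i h1 h2 => h i h1 (by omega))

lemma commute_longest {d : ℕ → B} {z : B} {n : ℕ} (h : ∀ i, i + 1 < n → Commute z (d i)) :
    Commute z (longest d n) := by
  induction n with
  | zero => exact Commute.one_right z
  | succ n ih =>
    exact (ih fun i hi => h i (by omega)).mul_right
      (commute_descWord fun i _ hi => h i (by omega))

lemma commute_prefixProd {x : ℕ → B} {z : B} {n : ℕ} (h : ∀ i, i < n → Commute z (x i)) :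
    Commute z (prefixProd x n) := by
  induction n with
  | zero => exact Commute.one_right z
  | succ n ih => exact (ih fun i hi => h i (by omega)).mul_right (h n (by omega))

lemma commute_staircase {x : ℕ → B} {z : B} {n : ℕ} (h : ∀ i, i + 1 < n → Commute z (x i)) :
    Commute z (staircase x n) := by
  induction n with
  | zero => exact Commute.one_right z
  | succ n ih =>
    exact (ih fun i hi => h i (by omega)).mul_right
      (commute_prefixProd fun i hi => h i (by omega))

end Words

/-! ### Calculus of ∂_{w₀}: annihilation by crossings, the idempotent, fullness, nilpotency of dots.
-/

namespace NilHeckeFamily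

variable {B : Type*} [Ring B] {a : ℕ} {x d : ℕ → B} (H : NilHeckeFamily a x d)

include H

/-- Moving a crossing across a full cycle lowers its index by one: far commutation, plus one braid
move where the indices meet. -/
lemma descWord_mul_d {n i : ℕ} (hn : n < a) (hi : i + 1 < n) :
    descWord d 0 n * d (i + 1) = d i * descWord d 0 n := by
  induction n with
  | zero => omega
  | succ n ih =>
    obtain h | rfl : i + 1 < n ∨ n = i + 1 := by omega
    · rw [descWord, mul_assoc, ih (by omega) h, ← mul_assoc, ← mul_assoc, zero_add]
      rw [(H.d_d i n (by omega) (by omega) (by omega)).eq]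
    · have hc : Commute (d (i + 1)) (descWord d 0 i) :=
        commute_descWord fun j _ hj => (H.d_d j (i + 1) (by omega) (by omega) (by omega)).symm
      simp only [descWord, zero_add]
      rw [mul_assoc, mul_assoc, ← hc.eq]
      simp only [← mul_assoc]
      rw [← H.braid i (by omega)]

/-- The last cycle in ∂_{w₀} ends in the crossing of index 0, which squares to zero; any other
crossing slides through that cycle and meets the shorter ∂_{w₀}. -/
lemma longest_mul_d {n i : ℕ} (hn : n ≤ a) (hi : i + 1 < n) : longest d n * d i = 0 := by
  induction n generalizing i with
  | zero => omega
  | succ n ih =>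
    rw [longest]
    cases i with
    | zero =>
      obtain ⟨m, rfl⟩ : ∃ m, n = m + 1 := ⟨n - 1, by omega⟩
      rw [descWord_succ_right, mul_assoc, mul_assoc, H.d_sq 0 (by omega), mul_zero, mul_zero]
    | succ i =>
      rw [mul_assoc, H.descWord_mul_d (by omega) (by omega), ← mul_assoc, ih (by omega) (by omega),
        zero_mul]

lemma descWord_mul_descWord {n m : ℕ} (hn : n < a) (hm : m + 1 ≤ n) :
    descWord d 0 n * descWord d 1 m = descWord d 0 m * descWord d 0 n := by
  induction m with
  | zero => simp [descWord]
  | succ m ih =>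
    rw [descWord, ← mul_assoc, add_comm 1 m, H.descWord_mul_d hn (by omega), mul_assoc,
      ih (by omega), descWord, ← mul_assoc, zero_add]

lemma descWord_sq {n : ℕ} (hn : n + 1 < a) :
    descWord d 0 (n + 1) * descWord d 0 (n + 1) = 0 := by
  nth_rewrite 2 [descWord_succ_right]
  rw [← mul_assoc, zero_add, H.descWord_mul_descWord hn le_rfl, descWord_succ_right, mul_assoc,
    mul_assoc, H.d_sq 0 (by omega), mul_zero, mul_zero]

lemma d_mul_longest {n i : ℕ} (hn : n ≤ a) (hi : i + 1 < n) : d i * longest d n = 0 := by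
  induction n with
  | zero => omega
  | succ n ih =>
    obtain h | rfl : i + 1 < n ∨ n = i + 1 := by omega
    · rw [longest, ← mul_assoc, ih (by omega) h, zero_mul]
    -- For the top crossing, ∂_{w₀} is split into the longest word on i strands followed by two
    -- cycles. The crossing passes the first factor and completes the shorter cycle to the longer
    -- one, whose square is zero.
    · have hc : Commute (d i) (longest d i) :=
        commute_longest fun j hj => (H.d_d j i (by omega) (by omega) (by omega)).symm
      have h0 := H.descWord_sq (n := i) (by omega)
      nth_rewrite 1 [descWord] at h0
      rw [zero_add] at h0
      rw [longest, longest, ← mul_assoc, ← mul_assoc, hc.eq, mul_assoc, mul_assoc, ← mul_assoc (d i),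
        h0, mul_zero]

lemma d_commute_prefixProd {i n : ℕ} (hn : n ≤ a) (hi : i + 1 < n) :
    Commute (d i) (prefixProd x n) := by
  induction n with
  | zero => omega
  | succ n ih =>
    obtain h | rfl : i + 1 < n ∨ n = i + 1 := by omega
    · exact (ih (by omega) h).mul_right (H.d_x i n (by omega) (by omega) (by omega) (by omega))
    · have h1 : Commute (d i) (prefixProd x i) :=
        commute_prefixProd fun j hj => H.d_x i j (by omega) (by omega) (by omega) (by omega)
      rw [prefixProd, prefixProd, mul_assoc]
      refine h1.mul_right ?_
      change _ = _
      rw [← mul_assoc, H.d_mul_x i (by omega), add_mul, mul_assoc, one_mul,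
        eq_sub_of_add_eq (H.x_mul_d i (by omega)).symm, mul_sub, mul_one,
        sub_add_cancel, ← mul_assoc, (H.x_x i (i + 1) (by omega) (by omega)).eq]

/-- On vectors killed by the crossings, crossings act on polynomial coefficients as divided
differences. Each of the `k` crossings of the cycle lowers one exponent of the staircase. -/
lemma descWord_mul_staircase {k : ℕ} (hk : k < a) {y : B} (hy : ∀ i < k, d i * y = 0) :
    descWord d 0 k * (staircase x (k + 1) * y) = staircase x k * y := by
  induction k generalizing y with
  | zero => simp [descWord, staircase, prefixProd]
  | succ k ih =>
    have h1 : ∀ i < k, d i * (prefixProd x (k + 1) * y) = 0 := fun i hi => by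
      rw [← mul_assoc, (H.d_commute_prefixProd (by omega) (by omega)).eq, mul_assoc,
        hy i (by omega), mul_zero]
    have h2 : Commute (d k) (staircase x k) :=
      commute_staircase fun j hj => H.d_x k j (by omega) (by omega) (by omega) (by omega)
    have h3 : Commute (d k) (prefixProd x k) :=
      commute_prefixProd fun j hj => H.d_x k j (by omega) (by omega) (by omega) (by omega)
    rw [staircase, mul_assoc, descWord, mul_assoc, ih (by omega) h1, zero_add, ← mul_assoc, h2.eq,
      mul_assoc, prefixProd, mul_assoc, ← mul_assoc (d k), h3.eq, mul_assoc, ← mul_assoc (d k),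
      H.d_mul_x k (by omega), add_mul, mul_assoc, hy k (by omega), mul_zero, zero_add, one_mul,
      staircase, mul_assoc]

/-- This is the identity ∂_{w₀}(ξ^δ) = 1; applied to `y` = ∂_{w₀} it yields the idempotent. -/
lemma longest_mul_staircase {n : ℕ} (hn : n ≤ a) {y : B} (hy : ∀ i, i + 1 < n → d i * y = 0) :
    longest d n * (staircase x n * y) = y := by
  induction n with
  | zero => simp [longest, staircase]
  | succ n ih =>
    rw [longest, mul_assoc, H.descWord_mul_staircase (by omega) fun i hi => hy i (by omega),
      ih (by omega) fun i hi => hy i (by omega)]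

lemma longest_mul_staircase_mul_longest :
    longest d a * (staircase x a * longest d a) = longest d a :=
  H.longest_mul_staircase le_rfl fun _ hi => H.d_mul_longest le_rfl hi

lemma isIdempotentElem : IsIdempotentElem (staircase x a * longest d a) := by
  rw [IsIdempotentElem, mul_assoc, H.longest_mul_staircase_mul_longest]

/-- Pushing the dot through the cycle leaves correction terms, each with one crossing omitted. If
that crossing is not the last, the crossings to its right commute past those to its left and are
killed by the longest word; only the term omitting `d k` survives. -/
lemma longest_mul_x_mul_descWord {k m : ℕ} (hn : k + m + 1 < a) :
    longest d (k + m + 1) * (x (k + m + 1) * descWord d k (m + 1)) =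
      longest d (k + m + 1) * (descWord d k (m + 1) * x k - descWord d (k + 1) m) := by
  induction m generalizing k with
  | zero =>
    simp only [descWord, add_zero, mul_one]
    rw [eq_sub_of_add_eq (H.d_mul_x k (by omega)).symm]
  | succ m ih =>
    have h := ih (k := k + 1) (by omega)
    have e : k + 1 + m + 1 = k + (m + 1) + 1 := by omega
    rw [e] at h
    have hc : Commute (d k) (descWord d (k + 1 + 1) m) :=
      commute_descWord fun j hj hj' => H.d_d k j (by omega) (by omega) (by omega)
    rw [descWord_succ_right d k, ← mul_assoc, ← mul_assoc, mul_assoc (longest _ _), h, mul_assoc,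
      sub_mul, mul_assoc _ _ (d k), ← hc.eq, eq_sub_of_add_eq (H.d_mul_x k (by omega)).symm, mul_sub,
      ← mul_assoc _ (d k) (descWord _ _ _), H.longest_mul_d (by omega) (by omega), zero_mul,
      sub_zero, mul_sub, mul_one, mul_assoc _ (d k)]

/-- The point is the shape of the right side: multiplying by dots on either side removes the last
crossing, so an ideal containing the longer word contains the shorter one. -/
lemma longest_mul_descWord_succ {k m : ℕ} (hn : k + m + 1 < a) :
    longest d (k + m + 1) * descWord d (k + 1) m =
      longest d (k + m + 1) * descWord d k (m + 1) * x k -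
        x (k + m + 1) * (longest d (k + m + 1) * descWord d k (m + 1)) := by
  have hc : Commute (x (k + m + 1)) (longest d (k + m + 1)) :=
    commute_longest fun j hj => (H.d_x j _ (by omega) hn (by omega) (by omega)).symm
  have h := H.longest_mul_x_mul_descWord hn
  rw [mul_sub] at h
  rw [← mul_assoc (x _), hc.eq, mul_assoc _ (x _), h, mul_assoc]
  abel

/-- The two-sided ideal generated by `∂_{w₀}` is everything. -/
lemma one_mem_of_longest_mem (I : TwoSidedIdeal B) (hI : longest d a ∈ I) : (1 : B) ∈ I := by
  suffices h : ∀ n, n ≤ a → longest d n ∈ I → (1 : B) ∈ I from h a le_rfl hI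
  intro n
  induction n with
  | zero => exact fun _ h => h
  | succ n ih =>
    intro hn h
    refine ih (by omega) ?_
    -- The last cycle is stripped one crossing at a time, from `k = 0`, where the word is the
    -- longest one on n + 1 strands, to `k = n`, where the cycle is empty.
    suffices h' : ∀ k m, k + m = n → longest d n * descWord d k m ∈ I by
      simpa [descWord] using h' n 0 (by omega)
    intro k
    induction k with
    | zero =>
      rintro m hm
      obtain rfl : m = n := by omega
      exact h
    | succ k ihk =>
      intro m hm
      obtain rfl : n = k + m + 1 := by omega
      have h' := ihk (m + 1) (by omega)
      rw [H.longest_mul_descWord_succ (by omega)]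
      exact I.sub_mem (I.mul_mem_right _ _ h') (I.mul_mem_left _ _ h')

lemma one_mem_of_idempotent_mem (I : TwoSidedIdeal B)
    (hI : staircase x a * longest d a ∈ I) : (1 : B) ∈ I := by
  refine H.one_mem_of_longest_mem I ?_
  rw [← H.longest_mul_staircase_mul_longest]
  exact I.mul_mem_left _ _ hI

lemma d_mul_x_pow {i : ℕ} (hi : i + 1 < a) (n : ℕ) :
    d i * x i ^ n = x (i + 1) ^ n * d i + ∑ j ∈ Finset.range n, x (i + 1) ^ j * x i ^ (n - 1 - j) := by
  induction n with
  | zero => simp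
  | succ n ih =>
    rw [pow_succ, ← mul_assoc, ih, add_mul, mul_assoc, H.d_mul_x i hi, mul_add, mul_one, pow_succ,
      ← mul_assoc, add_assoc, Finset.sum_range_succ, Finset.sum_mul, add_comm (x (i + 1) ^ n)]
    congr 2
    · refine Finset.sum_congr rfl fun j hj => ?_
      rw [Finset.mem_range] at hj
      rw [mul_assoc, ← pow_succ]
      congr 2
      omega
    · simp

/-- With S the complete homogeneous sum of degree n - 1 in the two dots, the commutation formula
gives S = -x_{i+1}^n d_i, so S d_i = 0. Inserting 1 = d_i x_i - x_{i+1} d_i after S gives S = 0, and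
S (x_{i+1} - x_i) = x_{i+1}^n - x_i^n finishes. -/
lemma x_succ_pow_eq_zero {i n : ℕ} (hi : i + 1 < a) (h : x i ^ n = 0) : x (i + 1) ^ n = 0 := by
  have hc := H.x_x (i + 1) i hi (by omega)
  have h1 := H.d_mul_x_pow hi n
  set S := ∑ j ∈ Finset.range n, x (i + 1) ^ j * x i ^ (n - 1 - j) with hS
  have hyS : Commute S (x (i + 1)) :=
    Commute.sum_left _ _ _ fun j _ => ((Commute.refl _).pow_left j).mul_left (hc.symm.pow_left _)
  rw [h, mul_zero] at h1
  have h2 : S * d i = 0 := by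
    rw [eq_neg_of_add_eq_zero_right h1.symm, neg_mul, mul_assoc, H.d_sq i hi, mul_zero, neg_zero]
  have h3 : S = 0 := by
    rw [← mul_one S, ← sub_eq_of_eq_add' (H.d_mul_x i hi), mul_sub, ← mul_assoc, h2, ← mul_assoc,
      hyS.eq, mul_assoc, h2, zero_mul, mul_zero, sub_zero]
  have h4 := hc.geom_sum₂_mul n
  rw [← hS, h3, zero_mul, h, sub_zero] at h4
  exact h4.symm

lemma x_pow_eq_zero {n : ℕ} (h : x 0 ^ n = 0) (i : ℕ) (hi : i < a) : x i ^ n = 0 := by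
  induction i with
  | zero => exact h
  | succ i ih => exact H.x_succ_pow_eq_zero hi (ih (by omega))

lemma exists_staircase_eq {n : ℕ} (hn : n < a) : ∃ z, staircase x (n + 1) = x 0 ^ n * z := by
  have hp : ∀ m, m < a → ∃ z, prefixProd x (m + 1) = x 0 * z := by
    intro m
    induction m with
    | zero => exact fun _ => ⟨1, by simp [prefixProd]⟩
    | succ m ih =>
      intro hm
      obtain ⟨z, hz⟩ := ih (by omega)
      exact ⟨z * x (m + 1), by rw [prefixProd, hz, mul_assoc]⟩
  induction n with
  | zero => exact ⟨staircase x 1, by simp⟩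
  | succ n ih =>
    obtain ⟨z, hz⟩ := ih (by omega)
    obtain ⟨w, hw⟩ := hp n (by omega)
    have hx : ∀ i < a, Commute (prefixProd x (n + 1)) (x i) := fun i hi =>
      (commute_prefixProd fun j hj => H.x_x i j hi (by omega)).symm
    have h1 : Commute (prefixProd x (n + 1)) (staircase x (n + 1)) :=
      commute_staircase fun i hi => hx i (by omega)
    refine ⟨w * z, ?_⟩
    rw [staircase, ← h1.eq, hz, ← mul_assoc, ((hx 0 (by omega)).pow_right n).eq, hw, pow_succ]
    simp only [mul_assoc]

/-- The nilHecke relations on more than `n` strands together with `x_0 ^ n = 0` force `1 = 0`. -/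
lemma subsingleton_of_pow_eq_zero {n : ℕ} (hn : n < a) (h : x 0 ^ n = 0) : Subsingleton B := by
  obtain ⟨b, rfl⟩ : ∃ b, a = b + 1 := ⟨a - 1, by omega⟩
  obtain ⟨z, hz⟩ := H.exists_staircase_eq (n := b) (by omega)
  have h0 : staircase x (b + 1) = 0 := by
    rw [hz, ← Nat.sub_add_cancel (show n ≤ b by omega), pow_add, h, mul_zero, zero_mul]
  -- The idempotent is zero, yet it generates the unit ideal.
  have h1 := H.one_mem_of_idempotent_mem ⊥ (by rw [h0, zero_mul]; exact zero_mem _)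
  exact subsingleton_of_zero_eq_one ((TwoSidedIdeal.mem_bot _).1 h1).symm

end NilHeckeFamily

/-- A full idempotent `e` of degree zero in a graded algebra such that `e A e` is concentrated in
non-negative degrees, with degree zero part spanned by `e`. -/
structure IsConnectedFullIdempotent {A : Type*} [Ring A] [Algebra ℚ A] (𝒜 : ℤ → Submodule ℚ A)
    (e : A) : Prop where
  idem : IsIdempotentElem e
  mem : e ∈ 𝒜 0
  full : ∀ I : TwoSidedIdeal A, e ∈ I → 1 ∈ I
  corner_neg : ∀ i < 0, ∀ x ∈ 𝒜 i, e * x * e = 0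
  corner_zero : ∀ x ∈ 𝒜 0, ∃ c : ℚ, e * x * e = c • e

/-! ### Finite dimensionality -/

lemma finite_adjoin_of_commute_of_isNilpotent {K B : Type*} [Field K] [Ring B] [Algebra K B]
    {s : Set B} (hs : s.Finite) (hcomm : ∀ x ∈ s, ∀ y ∈ s, x * y = y * x)
    (hnil : ∀ x ∈ s, IsNilpotent x) :
    FiniteDimensional K (Subalgebra.toSubmodule (Algebra.adjoin K s)) := by
  have := Algebra.isMulCommutative_adjoin K hcomm
  let : CommRing (Algebra.adjoin K s) := { mul_comm := mul_comm' }
  set t : Set (Algebra.adjoin K s) := ((↑) : Algebra.adjoin K s → B) ⁻¹' s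
  have ht : t.Finite := hs.preimage Subtype.val_injective.injOn
  have h := fg_adjoin_of_finite (R := K) ht fun x hx => by
    obtain ⟨n, hn⟩ := hnil x hx
    refine ⟨Polynomial.X ^ n, Polynomial.monic_X_pow n, ?_⟩
    simp only [Polynomial.eval₂_X_pow]
    exact Subtype.ext (by simpa using hn)
  rw [Algebra.adjoin_adjoin_coe_preimage] at h
  exact (⟨h⟩ : Module.Finite K (Algebra.adjoin K s))

/-- The elements `b` such that the left ideal `B b` is finite dimensional. -/
def finiteLeftIdeal (K B : Type*) [Field K] [Ring B] [Algebra K B] : TwoSidedIdeal B :=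
  TwoSidedIdeal.mk' {b | FiniteDimensional K (LinearMap.range (LinearMap.mulRight K b))}
    (by
      change FiniteDimensional K (LinearMap.range (LinearMap.mulRight K (0 : B)))
      rw [LinearMap.mulRight_zero_eq_zero, LinearMap.range_zero]
      infer_instance)
    (by
      rintro x y (hx : FiniteDimensional K _) (hy : FiniteDimensional K _)
      refine Submodule.finiteDimensional_of_le
        (S₂ := LinearMap.range (LinearMap.mulRight K x) ⊔ LinearMap.range (LinearMap.mulRight K y)) ?_
      rintro _ ⟨z, rfl⟩
      rw [LinearMap.mulRight_apply, mul_add]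
      exact Submodule.add_mem_sup ⟨z, rfl⟩ ⟨z, rfl⟩)
    (by
      rintro x (hx : FiniteDimensional K _)
      refine Submodule.finiteDimensional_of_le (S₂ := LinearMap.range (LinearMap.mulRight K x)) ?_
      rintro _ ⟨z, rfl⟩
      exact ⟨-z, by simp⟩)
    (by
      rintro y x (hx : FiniteDimensional K _)
      refine Submodule.finiteDimensional_of_le (S₂ := LinearMap.range (LinearMap.mulRight K x)) ?_
      rintro _ ⟨z, rfl⟩
      exact ⟨z * y, by simp [mul_assoc]⟩)
    (by
      rintro x y (hx : FiniteDimensional K _)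
      refine Submodule.finiteDimensional_of_le
        (S₂ := (LinearMap.range (LinearMap.mulRight K x)).map (LinearMap.mulRight K y)) ?_
      rintro _ ⟨z, rfl⟩
      exact ⟨z * x, ⟨z, rfl⟩, by simp [mul_assoc]⟩)

lemma mem_finiteLeftIdeal {K B : Type*} [Field K] [Ring B] [Algebra K B] {b : B} :
    b ∈ finiteLeftIdeal K B ↔ FiniteDimensional K (LinearMap.range (LinearMap.mulRight K b)) := by
  rw [finiteLeftIdeal, TwoSidedIdeal.mem_mk']
  rfl

lemma finite_of_one_mem_finiteLeftIdeal {K B : Type*} [Field K] [Ring B] [Algebra K B]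
    (h : (1 : B) ∈ finiteLeftIdeal K B) : FiniteDimensional K B := by
  rw [mem_finiteLeftIdeal, LinearMap.mulRight_one, LinearMap.range_id] at h
  exact Module.Finite.equiv (Submodule.topEquiv (R := K) (M := B))

/-! ### The left ideal generated by `∂_{w₀}` -/

section PolyLongest

variable {B : Type*} [Ring B] [Algebra ℚ B]

/-- The span of the elements `p ∂_{w₀}` with `p` a monomial of degree `m` in the dots, where dots
have degree two. -/
def polyLongest (a : ℕ) (x d : ℕ → B) (m : ℤ) : Submodule ℚ B :=
  Submodule.span ℚ {y | ∃ w : List ℕ, (∀ i ∈ w, i < a) ∧ 2 * (w.length : ℤ) = m ∧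
    y = (w.map x).prod * longest d a}

variable {a : ℕ} {x d : ℕ → B}

lemma polyLongest_neg {m : ℤ} (hm : m < 0) : polyLongest a x d m = ⊥ := by
  rw [polyLongest, Submodule.span_eq_bot]
  rintro _ ⟨w, _, hw, _⟩
  omega

lemma exists_smul_of_mem_polyLongest {y : B} (hy : y ∈ polyLongest a x d 0) :
    ∃ c : ℚ, y = c • longest d a := by
  have h : polyLongest a x d 0 ≤ Submodule.span ℚ {longest d a} := by
    refine Submodule.span_mono ?_
    rintro _ ⟨w, _, hw, rfl⟩
    obtain rfl : w = [] := List.length_eq_zero_iff.1 (by omega)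
    simp
  obtain ⟨c, rfl⟩ := Submodule.mem_span_singleton.1 (h hy)
  exact ⟨c, rfl⟩

lemma dot_mul_mem_polyLongest {m : ℤ} {i : ℕ} (hi : i < a) {y : B}
    (hy : y ∈ polyLongest a x d m) : x i * y ∈ polyLongest a x d (2 + m) := by
  have h : polyLongest a x d m ≤
      (polyLongest a x d (2 + m)).comap (LinearMap.mulLeft ℚ (x i)) := by
    rw [polyLongest, Submodule.span_le]
    rintro _ ⟨w, hw, rfl, rfl⟩
    refine Submodule.subset_span ⟨i :: w, ?_, ?_, ?_⟩
    · simpa [hi] using hw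
    · push_cast [List.length_cons]
      ring
    · simp [mul_assoc]
  exact h hy

namespace NilHeckeFamily

variable (H : NilHeckeFamily a x d)

include H

/-- A crossing moves right past the dots until it dies on ∂_{w₀}; each correction term loses one dot
and the crossing, so the degrees agree. -/
lemma crossing_mul_mem_polyLongest {m : ℤ} {i : ℕ} (hi : i + 1 < a) {y : B}
    (hy : y ∈ polyLongest a x d m) : d i * y ∈ polyLongest a x d (-2 + m) := by
  have key : ∀ w : List ℕ, (∀ i ∈ w, i < a) →
      d i * ((w.map x).prod * longest d a) ∈ polyLongest a x d (-2 + 2 * (w.length : ℤ)) := by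
    intro w
    induction w with
    | nil =>
      intro _
      simp [H.d_mul_longest le_rfl hi]
    | cons j w ih =>
      intro hw
      simp only [List.mem_cons, forall_eq_or_imp] at hw
      have ih := ih hw.2
      have hm : (w.map x).prod * longest d a ∈ polyLongest a x d (2 + (-2 + 2 * (w.length : ℤ))) :=
        Submodule.subset_span ⟨w, hw.2, by ring, rfl⟩
      have hd : -2 + 2 * (((j :: w).length : ℕ) : ℤ) = 2 + (-2 + 2 * (w.length : ℤ)) := by
        push_cast [List.length_cons]
        ring
      rw [List.map_cons, List.prod_cons, mul_assoc, hd]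
      generalize (w.map x).prod * longest d a = z at ih hm
      rw [← mul_assoc]
      rcases eq_or_ne j i with rfl | h1
      · rw [H.d_mul_x j hi, add_mul, one_mul, mul_assoc]
        exact add_mem (dot_mul_mem_polyLongest hi ih) hm
      rcases eq_or_ne j (i + 1) with rfl | h2
      · rw [eq_sub_of_add_eq (H.x_mul_d i hi).symm, sub_mul, one_mul, mul_assoc]
        exact sub_mem (dot_mul_mem_polyLongest (by omega) ih) hm
      · rw [(H.d_x i j hi hw.1 h1 h2).eq, mul_assoc]
        exact dot_mul_mem_polyLongest hw.1 ih
  have h : polyLongest a x d m ≤ (polyLongest a x d (-2 + m)).comap (LinearMap.mulLeft ℚ (d i)) := by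
    rw [polyLongest, Submodule.span_le]
    rintro _ ⟨w, hw, rfl, rfl⟩
    exact key w hw
  exact h hy

lemma word_mul_longest_mem {f : Gen a → B} (hx : ∀ i h, f (Gen.xi i h) = x i)
    (hd : ∀ i h, f (Gen.del i h) = d i) (w : List (Gen a)) :
    (w.map f).prod * longest d a ∈ polyLongest a x d (w.map Gen.deg).sum := by
  induction w with
  | nil => exact Submodule.subset_span ⟨[], by simp, by simp, by simp⟩
  | cons g w ih =>
    simp only [List.map_cons, List.prod_cons, List.sum_cons, mul_assoc]
    cases g with
    | xi i hi =>
      rw [hx]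
      exact dot_mul_mem_polyLongest hi ih
    | del i hi =>
      rw [hd]
      exact H.crossing_mul_mem_polyLongest hi ih

lemma mul_longest_mem {f : Gen a → B} (hx : ∀ i h, f (Gen.xi i h) = x i)
    (hd : ∀ i h, f (Gen.del i h) = d i) {m : ℤ} {y : B}
    (hy : y ∈ Submodule.span ℚ
      {y | ∃ w : List (Gen a), (w.map Gen.deg).sum = m ∧ y = (w.map f).prod}) :
    y * longest d a ∈ polyLongest a x d m := by
  have h : Submodule.span ℚ
      {y | ∃ w : List (Gen a), (w.map Gen.deg).sum = m ∧ y = (w.map f).prod} ≤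
      (polyLongest a x d m).comap (LinearMap.mulRight ℚ (longest d a)) := by
    rw [Submodule.span_le]
    rintro _ ⟨w, rfl, rfl⟩
    exact H.word_mul_longest_mem hx hd w
  exact h hy

/-- The left ideal of ∂_{w₀} lies in the image of the commutative algebra generated by the nilpotent
dots, so it is finite-dimensional. Elements with this property form a two-sided ideal, and one
containing ∂_{w₀} contains 1. -/
lemma finiteDimensional {N : ℕ} (hN : ∀ i < a, x i ^ N = 0)
    (hB : ∀ y, ∃ (s : Finset ℤ) (f : ℤ → B), y = ∑ i ∈ s, f i ∧
      ∀ i ∈ s, f i * longest d a ∈ polyLongest a x d i) : FiniteDimensional ℚ B := by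
  refine finite_of_one_mem_finiteLeftIdeal (H.one_mem_of_longest_mem _ ?_)
  rw [mem_finiteLeftIdeal]
  have hfin := finite_adjoin_of_commute_of_isNilpotent (K := ℚ) (s := x '' Set.Iio a)
    ((Set.finite_Iio a).image _)
    (by
      rintro _ ⟨i, hi, rfl⟩ _ ⟨j, hj, rfl⟩
      exact H.x_x i j hi hj)
    (by
      rintro _ ⟨i, hi, rfl⟩
      exact ⟨N, hN i hi⟩)
  refine Submodule.finiteDimensional_of_le
    (S₂ := (Subalgebra.toSubmodule (Algebra.adjoin ℚ (x '' Set.Iio a))).map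
      (LinearMap.mulRight ℚ (longest d a))) ?_
  rintro _ ⟨y, rfl⟩
  have hle : ∀ m, polyLongest a x d m ≤
      (Subalgebra.toSubmodule (Algebra.adjoin ℚ (x '' Set.Iio a))).map
        (LinearMap.mulRight ℚ (longest d a)) := by
    intro m
    rw [polyLongest, Submodule.span_le]
    rintro _ ⟨w, hw, _, rfl⟩
    refine ⟨_, Subalgebra.list_prod_mem _ fun y hy => ?_, rfl⟩
    obtain ⟨i, hi, rfl⟩ := List.mem_map.1 hy
    exact Algebra.subset_adjoin ⟨i, hw i hi, rfl⟩
  obtain ⟨s, f, rfl, hf⟩ := hB y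
  rw [LinearMap.mulRight_apply, Finset.sum_mul]
  exact Submodule.sum_mem _ fun i hi => hle i (hf i hi)

end NilHeckeFamily

end PolyLongest

namespace CycNH

/-! ### The structure of the cyclotomic nilHecke algebra -/

section

variable (a N : ℕ)

/-- The dot `ξ_{i+1}` of `NH_a^N`, or zero if `i` is out of range. -/
def dot (i : ℕ) : CycNH a N := if h : i < a then gen N (Gen.xi i h) else 0

/-- The crossing `∂_{i+1}` of `NH_a^N`, or zero if `i` is out of range. -/
def crossing (i : ℕ) : CycNH a N := if h : i + 1 < a then gen N (Gen.del i h) else 0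

variable {a}

lemma gen_xi {i : ℕ} (h : i < a) : gen N (Gen.xi i h) = dot a N i := by rw [dot, dif_pos h]

lemma gen_del {i : ℕ} (h : i + 1 < a) : gen N (Gen.del i h) = crossing a N i := by
  rw [crossing, dif_pos h]

variable (a)

lemma nilHeckeFamily : NilHeckeFamily a (dot a N) (crossing a N) where
  x_x i j hi hj := by
    simpa [commute_iff_eq, gen_xi] using rel_gen N (Rel.xi_xi i j hi hj)
  d_x i j hi hj h1 h2 := by
    simpa [commute_iff_eq, gen_xi, gen_del] using rel_gen N (Rel.del_xi i j hi hj h1 h2)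
  d_d i j hi hj hij := by
    simpa [commute_iff_eq, gen_del] using rel_gen N (Rel.del_del i j hi hj hij)
  d_sq i hi := by simpa [gen_del] using rel_gen N (Rel.del_sq i hi)
  braid i hi := by simpa [gen_del] using rel_gen N (Rel.braid i hi)
  x_mul_d i hi := by simpa [gen_xi, gen_del] using rel_gen N (Rel.xi_del i hi)
  d_mul_x i hi := by simpa [gen_xi, gen_del] using rel_gen N (Rel.del_xi_self i hi)

lemma dot_zero_pow (ha : 0 < a) : dot a N 0 ^ N = 0 := by
  rw [← gen_xi N ha, gen, ← map_pow, RingQuot.mkAlgHom_rel ℚ (CycRel.xi_pow (N := N) ha), map_zero]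

lemma dot_pow (i : ℕ) (hi : i < a) : dot a N i ^ N = 0 :=
  (nilHeckeFamily a N).x_pow_eq_zero (dot_zero_pow a N (by omega)) i hi

lemma subsingleton_of_lt (h : N < a) : Subsingleton (CycNH a N) :=
  (nilHeckeFamily a N).subsingleton_of_pow_eq_zero h (dot_zero_pow a N (by omega))

lemma dot_mem (i : ℕ) : dot a N i ∈ grading a N 2 := by
  by_cases h : i < a
  · rw [← gen_xi N h]
    exact gen_mem N (Gen.xi i h)
  · rw [dot, dif_neg h]
    exact zero_mem _

lemma crossing_mem (i : ℕ) : crossing a N i ∈ grading a N (-2) := by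
  by_cases h : i + 1 < a
  · rw [← gen_del N h]
    exact gen_mem N (Gen.del i h)
  · rw [crossing, dif_neg h]
    exact zero_mem _

lemma mul_mem_grading {i j k : ℤ} {x y : CycNH a N} (hx : x ∈ grading a N i)
    (hy : y ∈ grading a N j) (h : i + j = k) : x * y ∈ grading a N k :=
  h ▸ SetLike.GradedMul.mul_mem hx hy

lemma one_mem_grading : (1 : CycNH a N) ∈ grading a N 0 := SetLike.GradedOne.one_mem

lemma descWord_mem (k m : ℕ) : descWord (crossing a N) k m ∈ grading a N (-2 * m) := by
  induction m with
  | zero => simpa [descWord, longest, prefixProd, staircase] using one_mem_grading a N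
  | succ m ih =>
    exact mul_mem_grading a N (crossing_mem a N _) ih (by push_cast; ring)

lemma longest_mem (n : ℕ) : longest (crossing a N) n ∈ grading a N (-(n * (n - 1))) := by
  induction n with
  | zero => simpa [descWord, longest, prefixProd, staircase] using one_mem_grading a N
  | succ n ih => exact mul_mem_grading a N ih (descWord_mem a N _ _) (by push_cast; ring)

lemma prefixProd_mem (n : ℕ) : prefixProd (dot a N) n ∈ grading a N (2 * n) := by
  induction n with
  | zero => simpa [descWord, longest, prefixProd, staircase] using one_mem_grading a N
  | succ n ih => exact mul_mem_grading a N ih (dot_mem a N _) (by push_cast; ring)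

lemma staircase_mem (n : ℕ) : staircase (dot a N) n ∈ grading a N (n * (n - 1)) := by
  induction n with
  | zero => simpa [descWord, longest, prefixProd, staircase] using one_mem_grading a N
  | succ n ih => exact mul_mem_grading a N ih (prefixProd_mem a N _) (by push_cast; ring)

/-- The idempotent `ξ^δ ∂_{w₀}`. -/
def idempotent : CycNH a N := staircase (dot a N) a * longest (crossing a N) a

variable {a N}

lemma grading_mul_longest_mem {m : ℤ} {x : CycNH a N} (hx : x ∈ grading a N m) :
    x * longest (crossing a N) a ∈ polyLongest a (dot a N) (crossing a N) m :=
  (nilHeckeFamily a N).mul_longest_mem (fun _ h => gen_xi N h) (fun _ h => gen_del N h) hx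

/-- In e x e = ξ^δ (∂_{w₀} x ξ^δ) ∂_{w₀} the degrees of ∂_{w₀} and ξ^δ cancel, so the bracket has
the degree of `x`. -/
lemma idempotent_corner {d : ℤ} {x : CycNH a N} (hx : x ∈ grading a N d) :
    ∃ y ∈ polyLongest a (dot a N) (crossing a N) d, idempotent a N * x * idempotent a N = staircase (dot a N) a * y := by
  have h1 : longest (crossing a N) a * x * staircase (dot a N) a ∈ grading a N d :=
    mul_mem_grading a N (mul_mem_grading a N (longest_mem a N a) hx rfl) (staircase_mem a N a)
      (by ring)
  exact ⟨_, grading_mul_longest_mem h1, by simp only [idempotent, mul_assoc]⟩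

variable (a N)

lemma isConnectedFullIdempotent : IsConnectedFullIdempotent (grading a N) (idempotent a N) where
  idem := (nilHeckeFamily a N).isIdempotentElem
  mem := mul_mem_grading a N (staircase_mem a N a) (longest_mem a N a) (by ring)
  full := (nilHeckeFamily a N).one_mem_of_idempotent_mem
  corner_neg i hi x hx := by
    obtain ⟨y, hy, h⟩ := idempotent_corner hx
    rw [polyLongest_neg hi, Submodule.mem_bot] at hy
    rw [h, hy, mul_zero]
  corner_zero x hx := by
    obtain ⟨y, hy, h⟩ := idempotent_corner hx
    obtain ⟨c, rfl⟩ := exists_smul_of_mem_polyLongest hy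
    exact ⟨c, by rw [h, idempotent, mul_smul_comm]⟩

lemma finiteDimensional : FiniteDimensional ℚ (CycNH a N) := by
  classical
  exact (nilHeckeFamily a N).finiteDimensional (dot_pow a N) fun y =>
    ⟨_, fun i => DirectSum.decompose (grading a N) y i,
      (DirectSum.sum_support_decompose (grading a N) y).symm,
      fun i _ => grading_mul_longest_mem (DirectSum.decompose (grading a N) y i).2⟩

end

end CycNH

/-! ### The polynomial representation -/

section Polynomial

open MvPolynomial

/-- The simple transposition `s_i`, acting on polynomials. -/
def simpleSwap (i : ℕ) : MvPolynomial ℕ ℚ →ₐ[ℚ] MvPolynomial ℕ ℚ :=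
  rename (Equiv.swap i (i + 1))

lemma simpleSwap_X (i j : ℕ) : simpleSwap i (X j) = X (Equiv.swap i (i + 1) j) := by
  simp [simpleSwap]

@[simp]
lemma simpleSwap_X_self (i : ℕ) : simpleSwap i (X i) = X (i + 1) := by
  rw [simpleSwap_X, Equiv.swap_apply_left]

@[simp]
lemma simpleSwap_X_succ (i : ℕ) : simpleSwap i (X (i + 1)) = X i := by
  rw [simpleSwap_X, Equiv.swap_apply_right]

lemma simpleSwap_X_of_ne {i j : ℕ} (h1 : j ≠ i) (h2 : j ≠ i + 1) : simpleSwap i (X j) = X j := by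
  rw [simpleSwap_X, Equiv.swap_apply_of_ne_of_ne h1 h2]

lemma simpleSwap_simpleSwap (i : ℕ) (f : MvPolynomial ℕ ℚ) :
    simpleSwap i (simpleSwap i f) = f := by
  simp [simpleSwap, rename_rename, ← Equiv.coe_trans]

lemma simpleSwap_comm {i j : ℕ} (h : i + 1 < j) (f : MvPolynomial ℕ ℚ) :
    simpleSwap i (simpleSwap j f) = simpleSwap j (simpleSwap i f) := by
  simp only [simpleSwap, rename_rename]
  congr 2
  ext n
  simp only [Function.comp_apply, Equiv.swap_apply_def]
  grind

lemma simpleSwap_braid (i : ℕ) (f : MvPolynomial ℕ ℚ) :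
    simpleSwap i (simpleSwap (i + 1) (simpleSwap i f)) =
      simpleSwap (i + 1) (simpleSwap i (simpleSwap (i + 1) f)) := by
  simp only [simpleSwap, rename_rename]
  congr 2
  ext n
  simp only [Function.comp_apply, Equiv.swap_apply_def]
  grind

lemma X_sub_X_succ_dvd (i : ℕ) (f : MvPolynomial ℕ ℚ) :
    (X i - X (i + 1) : MvPolynomial ℕ ℚ) ∣ f - simpleSwap i f := by
  induction f using MvPolynomial.induction_on with
  | C c => simp [simpleSwap]
  | add f g hf hg =>
    rw [map_add, add_sub_add_comm]
    exact dvd_add hf hg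
  | mul_X f j hf =>
    have h : (X i - X (i + 1) : MvPolynomial ℕ ℚ) ∣ X j - simpleSwap i (X j) := by
      rcases eq_or_ne j i with rfl | h1
      · simp
      rcases eq_or_ne j (i + 1) with rfl | h2
      · rw [simpleSwap_X_succ, ← dvd_neg, neg_sub]
      · simp [simpleSwap_X_of_ne h1 h2]
    have e : f * X j - simpleSwap i (f * X j) =
        (f - simpleSwap i f) * X j + simpleSwap i f * (X j - simpleSwap i (X j)) := by
      rw [map_mul]
      ring
    rw [e]
    exact dvd_add (hf.mul_right _) (h.mul_left _)

lemma X_sub_X_ne_zero {i j : ℕ} (h : i ≠ j) : (X i - X j : MvPolynomial ℕ ℚ) ≠ 0 :=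
  sub_ne_zero.2 fun h' => h (X_injective h')

/-- The divided difference operator `f ↦ (f - s_i f) / (x_i - x_{i+1})`. -/
def divDiff (i : ℕ) : Module.End ℚ (MvPolynomial ℕ ℚ) where
  toFun f := (X_sub_X_succ_dvd i f).choose
  map_add' f g := by
    refine mul_left_cancel₀ (X_sub_X_ne_zero (Nat.succ_ne_self i).symm) ?_
    rw [mul_add, ← (X_sub_X_succ_dvd i _).choose_spec, ← (X_sub_X_succ_dvd i f).choose_spec,
      ← (X_sub_X_succ_dvd i g).choose_spec, map_add]
    ring
  map_smul' c f := by
    refine mul_left_cancel₀ (X_sub_X_ne_zero (Nat.succ_ne_self i).symm) ?_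
    rw [RingHom.id_apply, mul_smul_comm, ← (X_sub_X_succ_dvd i _).choose_spec,
      ← (X_sub_X_succ_dvd i f).choose_spec, map_smul, smul_sub]

lemma mul_divDiff (i : ℕ) (f : MvPolynomial ℕ ℚ) :
    (X i - X (i + 1)) * divDiff i f = f - simpleSwap i f :=
  (X_sub_X_succ_dvd i f).choose_spec.symm

/-- Identities between divided differences are checked below by clearing denominators in this way.
-/
lemma divDiff_ext {i : ℕ} {f g : MvPolynomial ℕ ℚ}
    (h : (X i - X (i + 1)) * f = (X i - X (i + 1)) * g) : f = g :=
  mul_left_cancel₀ (X_sub_X_ne_zero (Nat.succ_ne_self i).symm) h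

lemma divDiff_eq_zero {i : ℕ} {f : MvPolynomial ℕ ℚ} (h : simpleSwap i f = f) :
    divDiff i f = 0 :=
  divDiff_ext (by rw [mul_divDiff, h, sub_self, mul_zero])

lemma simpleSwap_divDiff (i : ℕ) (f : MvPolynomial ℕ ℚ) :
    simpleSwap i (divDiff i f) = divDiff i f := by
  refine divDiff_ext (i := i) ?_
  have h := congrArg (simpleSwap i) (mul_divDiff i f)
  simp only [map_mul, map_sub, simpleSwap_X_self, simpleSwap_X_succ, simpleSwap_simpleSwap] at h
  linear_combination -h - mul_divDiff i f

lemma divDiff_mul_of_invariant {i : ℕ} {g : MvPolynomial ℕ ℚ} (h : simpleSwap i g = g)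
    (f : MvPolynomial ℕ ℚ) : divDiff i (f * g) = divDiff i f * g := by
  refine divDiff_ext (i := i) ?_
  rw [mul_divDiff, ← mul_assoc, mul_divDiff, map_mul, h]
  ring

lemma divDiff_comm {i j : ℕ} (h : i + 1 < j) (f : MvPolynomial ℕ ℚ) :
    divDiff i (divDiff j f) = divDiff j (divDiff i f) := by
  refine divDiff_ext (i := i) (divDiff_ext (i := j) ?_)
  have h1 := congrArg (simpleSwap i) (mul_divDiff j f)
  have h2 := congrArg (simpleSwap j) (mul_divDiff i f)
  rw [map_mul, map_sub, map_sub, simpleSwap_X_of_ne (by omega) (by omega),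
    simpleSwap_X_of_ne (by omega) (by omega)] at h1 h2
  rw [mul_divDiff, mul_left_comm, mul_divDiff]
  linear_combination mul_divDiff j f - h1 - mul_divDiff i f + h2 + simpleSwap_comm h f

/-- Multiplied by the Vandermonde product in the three variables, both sides become the
antisymmetrization of `f` over S_3. The `a` equations expand the left side, the `b` equations the
right one. -/
lemma divDiff_braid (i : ℕ) (f : MvPolynomial ℕ ℚ) :
    divDiff i (divDiff (i + 1) (divDiff i f)) =
      divDiff (i + 1) (divDiff i (divDiff (i + 1) f)) := by
  have hne : (X i - X (i + 1 + 1) : MvPolynomial ℕ ℚ) ≠ 0 := X_sub_X_ne_zero (by omega)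
  have e0 : simpleSwap (i + 1) (X i) = X i := simpleSwap_X_of_ne (by omega) (by omega)
  have e2 : simpleSwap i (X (i + 1 + 1)) = X (i + 1 + 1) :=
    simpleSwap_X_of_ne (by omega) (by omega)
  refine divDiff_ext (i := i) (divDiff_ext (i := i + 1) (mul_left_cancel₀ hne ?_))
  have a1 := mul_divDiff i f
  have a2 := congrArg (simpleSwap (i + 1)) a1
  have a3 := congrArg (simpleSwap i) a2
  have a4 := mul_divDiff (i + 1) (divDiff i f)
  have a5 := congrArg (simpleSwap i) a4
  have a6 := mul_divDiff i (divDiff (i + 1) (divDiff i f))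
  have b1 := mul_divDiff (i + 1) f
  have b2 := congrArg (simpleSwap i) b1
  have b3 := congrArg (simpleSwap (i + 1)) b2
  have b4 := mul_divDiff i (divDiff (i + 1) f)
  have b5 := congrArg (simpleSwap (i + 1)) b4
  have b6 := mul_divDiff (i + 1) (divDiff i (divDiff (i + 1) f))
  simp only [map_mul, map_sub, simpleSwap_X_self, simpleSwap_X_succ, e0, e2,
    simpleSwap_divDiff] at a2 a3 a5 b2 b3 b5
  have hb := simpleSwap_braid i f
  linear_combination (X i - X (i + 1 + 1)) * (X (i + 1) - X (i + 1 + 1)) * a6 +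
    (X i - X (i + 1 + 1)) * a4 - (X (i + 1) - X (i + 1 + 1)) * a5 + a1 - a2 + a3 -
    (X i - X (i + 1 + 1)) * (X i - X (i + 1)) * b6 -
    (X i - X (i + 1 + 1)) * b4 + (X i - X (i + 1)) * b5 - b1 + b2 - b3 - hb

lemma polynomial_nilHeckeFamily (a : ℕ) :
    NilHeckeFamily a (fun i => LinearMap.mulLeft ℚ (X i : MvPolynomial ℕ ℚ)) divDiff where
  x_x i j _ _ := LinearMap.ext fun f => by
    simp only [Module.End.mul_apply, LinearMap.mulLeft_apply]
    ring
  d_x i j _ _ h1 h2 := LinearMap.ext fun f => by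
    simp only [Module.End.mul_apply, LinearMap.mulLeft_apply]
    rw [mul_comm, divDiff_mul_of_invariant (simpleSwap_X_of_ne h1 h2), mul_comm]
  d_d i j _ _ h := LinearMap.ext fun f => divDiff_comm h f
  d_sq i _ := LinearMap.ext fun f => divDiff_eq_zero (simpleSwap_divDiff i f)
  braid i _ := LinearMap.ext fun f => divDiff_braid i f
  x_mul_d i _ := LinearMap.ext fun f => divDiff_ext (i := i) (by
    simp only [Module.End.mul_apply, LinearMap.mulLeft_apply, LinearMap.add_apply,
      Module.End.one_apply]
    have h := mul_divDiff i (X (i + 1) * f)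
    rw [map_mul (simpleSwap i), simpleSwap_X_succ] at h
    linear_combination X i * mul_divDiff i f - h)
  d_mul_x i _ := LinearMap.ext fun f => divDiff_ext (i := i) (by
    simp only [Module.End.mul_apply, LinearMap.mulLeft_apply, LinearMap.add_apply,
      Module.End.one_apply]
    have h := mul_divDiff i (X i * f)
    rw [map_mul (simpleSwap i), simpleSwap_X_self] at h
    linear_combination h - X (i + 1) * mul_divDiff i f)

/-- The ideal generated by the polynomials without constant term that are symmetric in the first
`a` variables. -/
def coinvariantIdeal (a : ℕ) : Ideal (MvPolynomial ℕ ℚ) :=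
  Ideal.span {f | constantCoeff f = 0 ∧ ∀ i, i + 1 < a → simpleSwap i f = f}

lemma one_notMem_coinvariantIdeal (a : ℕ) : 1 ∉ coinvariantIdeal a := by
  have h : coinvariantIdeal a ≤ RingHom.ker (constantCoeff (R := ℚ) (σ := ℕ)) :=
    Ideal.span_le.2 fun f hf => hf.1
  intro h1
  simpa using h h1

lemma divDiff_mem_coinvariantIdeal {a i : ℕ} (hi : i + 1 < a) {f : MvPolynomial ℕ ℚ}
    (hf : f ∈ coinvariantIdeal a) : divDiff i f ∈ coinvariantIdeal a := by
  -- Divided differences are linear only over invariants, so the induction over the ideal must carry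
  -- an arbitrary multiplier `r`.
  suffices h : ∀ r, divDiff i (r * f) ∈ coinvariantIdeal a by simpa using h 1
  refine Submodule.span_induction (p := fun f _ => ∀ r, divDiff i (r * f) ∈ coinvariantIdeal a)
    ?_ ?_ ?_ ?_ hf
  · intro g hg r
    rw [divDiff_mul_of_invariant (hg.2 i hi)]
    exact Ideal.mul_mem_left _ _ (Ideal.subset_span hg)
  · simp
  · intro g g' _ _ h h' r
    rw [mul_add, map_add]
    exact add_mem (h r) (h' r)
  · intro c g _ h r
    rw [smul_eq_mul, ← mul_assoc]
    exact h _

/-- X_0 is a root of ∏_{j<a} (T - X_j), whose coefficients below the leading one are symmetric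
without constant term. -/
lemma X_pow_mem_coinvariantIdeal {a : ℕ} (ha : 0 < a) : X 0 ^ a ∈ coinvariantIdeal a := by
  set Q : Polynomial (MvPolynomial ℕ ℚ) :=
    ∏ j ∈ Finset.range a, (Polynomial.X - Polynomial.C (X j)) with hQ
  have hmonic : Q.Monic := Polynomial.monic_prod_X_sub_C _ _
  have hdeg : Q.natDegree = a := by
    rw [hQ, Polynomial.natDegree_finsetProd_X_sub_C_eq_card, Finset.card_range]
  have hswap : ∀ i, i + 1 < a → Q.map (simpleSwap i : MvPolynomial ℕ ℚ →+* _) = Q := by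
    intro i hi
    rw [hQ, Polynomial.map_prod]
    refine Finset.prod_equiv (Equiv.swap i (i + 1)) ?_ ?_
    · intro j
      simp only [Finset.mem_range, Equiv.swap_apply_def]
      grind
    · intro j _
      simp [simpleSwap_X]
  have hconst : Q.map (constantCoeff (R := ℚ) (σ := ℕ)) = Polynomial.X ^ a := by
    rw [hQ, Polynomial.map_prod]
    simp
  have hmem : ∀ k < a, Q.coeff k ∈ coinvariantIdeal a := by
    refine fun k hk => Ideal.subset_span ⟨?_, fun i hi => ?_⟩
    · rw [← Polynomial.coeff_map, hconst, Polynomial.coeff_X_pow, if_neg hk.ne]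
    · conv_rhs => rw [← hswap i hi, Polynomial.coeff_map]
      rfl
  have heval : Q.eval (X 0) = 0 := by
    rw [hQ, Polynomial.eval_prod]
    exact Finset.prod_eq_zero (Finset.mem_range.2 ha) (by simp)
  rw [hmonic.as_sum, hdeg, Polynomial.eval_add, Polynomial.eval_pow, Polynomial.eval_X,
    Polynomial.eval_finsetSum] at heval
  rw [eq_neg_of_add_eq_zero_left heval]
  refine neg_mem (sum_mem fun k hk => ?_)
  rw [Polynomial.eval_mul, Polynomial.eval_C]
  exact Ideal.mul_mem_right _ _ (hmem k (Finset.mem_range.1 hk))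

end Polynomial

/-- Operators satisfying the nilHecke relations and preserving a subspace induce such operators on
the quotient space. -/
lemma NilHeckeFamily.mapQ {K V : Type*} [Field K] [AddCommGroup V] [Module K V] {a : ℕ}
    {x d : ℕ → Module.End K V} (H : NilHeckeFamily a x d) (W : Submodule K V)
    {x' d' : ℕ → Module.End K (V ⧸ W)} (hx : ∀ i < a, ∀ f, x' i (Submodule.Quotient.mk f) = Submodule.Quotient.mk (x i f))
    (hd : ∀ i, i + 1 < a → ∀ f, d' i (Submodule.Quotient.mk f) = Submodule.Quotient.mk (d i f)) : NilHeckeFamily a x' d' where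
  x_x i j hi hj := Submodule.linearMap_qext _ <| LinearMap.ext fun f => by
    simpa [hx, hi, hj] using congrArg W.mkQ (DFunLike.congr_fun (H.x_x i j hi hj) f)
  d_x i j hi hj h1 h2 := Submodule.linearMap_qext _ <| LinearMap.ext fun f => by
    simpa [hx, hd, hi, hj] using congrArg W.mkQ (DFunLike.congr_fun (H.d_x i j hi hj h1 h2) f)
  d_d i j hi hj h := Submodule.linearMap_qext _ <| LinearMap.ext fun f => by
    simpa [hd, hi, hj] using congrArg W.mkQ (DFunLike.congr_fun (H.d_d i j hi hj h) f)
  d_sq i hi := Submodule.linearMap_qext _ <| LinearMap.ext fun f => by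
    simpa [hd, hi] using congrArg W.mkQ (DFunLike.congr_fun (H.d_sq i hi) f)
  braid i hi := Submodule.linearMap_qext _ <| LinearMap.ext fun f => by
    simpa [hd, hi, Nat.lt_of_succ_lt hi] using
      congrArg W.mkQ (DFunLike.congr_fun (H.braid i hi) f)
  x_mul_d i hi := Submodule.linearMap_qext _ <| LinearMap.ext fun f => by
    simpa [hx, hd, hi, Nat.lt_of_succ_lt hi] using
      congrArg W.mkQ (DFunLike.congr_fun (H.x_mul_d i hi) f)
  d_mul_x i hi := Submodule.linearMap_qext _ <| LinearMap.ext fun f => by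
    simpa [hx, hd, hi, Nat.lt_of_succ_lt hi] using
      congrArg W.mkQ (DFunLike.congr_fun (H.d_mul_x i hi) f)

/-! ### Representations of NH_a^N and its action on the coinvariant algebra. -/

section Lift

variable {B : Type*} [Ring B] [Algebra ℚ B] {a : ℕ} {x d : ℕ → B}

/-- The homomorphism out of `NH_a` given by a family satisfying the nilHecke relations. -/
def NH.lift (H : NilHeckeFamily a x d) : NH a →ₐ[ℚ] B :=
  RingQuot.liftAlgHom ℚ ⟨FreeAlgebra.lift ℚ fun g => match g with
    | .xi i _ => x i
    | .del i _ => d i, by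
    intro y z h
    cases h with
    | xi_xi i j hi hj => simpa using (H.x_x i j hi hj).eq
    | del_xi i j hi hj h₁ h₂ => simpa using (H.d_x i j hi hj h₁ h₂).eq
    | del_del i j hi hj hij => simpa using (H.d_d i j hi hj hij).eq
    | del_sq i hi => simpa using H.d_sq i hi
    | braid i hi => simpa using H.braid i hi
    | xi_del i hi => simpa using H.x_mul_d i hi
    | del_xi_self i hi => simpa using H.d_mul_x i hi⟩

lemma NH.lift_gen_xi (H : NilHeckeFamily a x d) (i : ℕ) (h : i < a) :
    NH.lift H (NH.gen (Gen.xi i h)) = x i := by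
  simp [NH.lift, NH.gen]

/-- The homomorphism out of `NH_a^N` given by a family satisfying the nilHecke relations and
`x_0 ^ N = 0`. -/
def CycNH.lift {N : ℕ} (H : NilHeckeFamily a x d) (h0 : 0 < a → x 0 ^ N = 0) :
    CycNH a N →ₐ[ℚ] B :=
  RingQuot.liftAlgHom ℚ ⟨NH.lift H, by
    intro y z h
    cases h with
    | xi_pow h => rw [map_pow, map_zero, NH.lift_gen_xi, h0 h]⟩

end Lift

/-- `NH_a^N` is not zero for `a ≤ N`: it acts on the coinvariant algebra. -/
lemma CycNH.nontrivial {a N : ℕ} (h : a ≤ N) : Nontrivial (CycNH a N) := by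
  set W : Submodule ℚ (MvPolynomial ℕ ℚ) := (coinvariantIdeal a).restrictScalars ℚ with hW
  let x' : ℕ → Module.End ℚ (MvPolynomial ℕ ℚ ⧸ W) := fun i =>
    W.mapQ W (LinearMap.mulLeft ℚ (MvPolynomial.X i)) fun f hf => Ideal.mul_mem_left _ _ hf
  -- The variables X_j with j ≥ a lie in the ideal, so divided differences with i + 1 ≥ a do not
  -- preserve it; the default 0 is used there.
  let d' : ℕ → Module.End ℚ (MvPolynomial ℕ ℚ ⧸ W) := fun i =>
    if hi : i + 1 < a then W.mapQ W (divDiff i) fun f hf => divDiff_mem_coinvariantIdeal hi hf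
    else 0
  have hx : ∀ i f, x' i (W.mkQ f) = W.mkQ (MvPolynomial.X i * f) := fun i f => rfl
  have H : NilHeckeFamily a x' d' := (polynomial_nilHeckeFamily a).mapQ W (fun i _ f => hx i f)
    fun i hi f => by
      simp only [d', dif_pos hi]
      rfl
  have hpow : ∀ n f, (x' 0 ^ n) (W.mkQ f) = W.mkQ (MvPolynomial.X 0 ^ n * f) := by
    intro n
    induction n with
    | zero => simp
    | succ n ih =>
      intro f
      rw [pow_succ, Module.End.mul_apply, hx, ih, pow_succ, mul_assoc]
  have h0 : 0 < a → x' 0 ^ N = 0 := fun ha => by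
    refine Submodule.linearMap_qext _ (LinearMap.ext fun f => ?_)
    rw [LinearMap.comp_apply, hpow, ← Nat.sub_add_cancel h, pow_add, LinearMap.comp_apply,
      LinearMap.zero_apply, Submodule.mkQ_apply, Submodule.Quotient.mk_eq_zero]
    exact Ideal.mul_mem_right _ _ (Ideal.mul_mem_left _ _ (X_pow_mem_coinvariantIdeal ha))
  have : Nontrivial (MvPolynomial ℕ ℚ ⧸ W) := by
    refine ⟨⟨W.mkQ 1, 0, fun h1 => one_notMem_coinvariantIdeal a ?_⟩⟩
    rwa [Submodule.mkQ_apply, Submodule.Quotient.mk_eq_zero] at h1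
  exact (CycNH.lift H h0).toRingHom.domain_nontrivial

/-! ### Graded modules and classes in the Grothendieck group -/

lemma isInternal_of_projections {V : Type*} [AddCommGroup V] (D : ℤ → AddSubgroup V)
    (π : ℤ → V →+ V) (hmem : ∀ i v, π i v ∈ D i) (hsame : ∀ i, ∀ v ∈ D i, π i v = v)
    (hne : ∀ i j, i ≠ j → ∀ v ∈ D j, π i v = 0) (hsum : ∀ v, ∃ s : Finset ℤ, ∑ i ∈ s, π i v = v) :
    DirectSum.IsInternal D := by
  constructor
  · refine (injective_iff_map_eq_zero _).2 fun z hz => ?_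
    have key : ∀ (z : DirectSum ℤ fun i => D i) (i : ℤ),
        π i (DirectSum.coeAddMonoidHom D z) = z i := by
      intro z i
      induction z using DirectSum.induction_on with
      | zero => simp
      | of j v =>
        rw [DirectSum.coeAddMonoidHom_of]
        rcases eq_or_ne i j with rfl | h
        · rw [hsame i v v.2, DirectSum.of_eq_same]
        · rw [hne i j h v v.2, DirectSum.of_eq_of_ne _ _ _ h]
          rfl
      | add x y hx hy => rw [map_add, map_add, hx, hy, DirectSum.add_apply, AddSubgroup.coe_add]
    ext i
    rw [← key, hz, map_zero]
    rfl
  · intro v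
    obtain ⟨s, hs⟩ := hsum v
    refine ⟨∑ i ∈ s, DirectSum.of (fun i => D i) i ⟨π i v, hmem i v⟩, ?_⟩
    rw [map_sum]
    simpa using hs

section Grothendieck

variable {A : Type} [Ring A] [Algebra ℚ A] {𝒜 : ℤ → Submodule ℚ A}

namespace GrProj

instance decomposition (M : GrProj 𝒜) : DirectSum.Decomposition M.deg :=
  M.isInternal.chooseDecomposition

/-- The projection to the homogeneous part of degree `i`. -/
def component (M : GrProj 𝒜) (i : ℤ) : M.carrier →+ M.carrier :=
  (M.deg i).subtype.comp ((DFinsupp.evalAddMonoidHom i).comp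
    (DirectSum.decomposeAddEquiv M.deg).toAddMonoidHom)

lemma component_apply (M : GrProj 𝒜) (i : ℤ) (m : M.carrier) :
    M.component i m = DirectSum.decompose M.deg m i := rfl

lemma component_mem (M : GrProj 𝒜) (i : ℤ) (m : M.carrier) : M.component i m ∈ M.deg i :=
  (DirectSum.decompose M.deg m i).2

lemma component_of_mem (M : GrProj 𝒜) {i : ℤ} {m : M.carrier} (h : m ∈ M.deg i) :
    M.component i m = m :=
  DirectSum.decompose_of_mem_same _ h

lemma component_of_mem_ne (M : GrProj 𝒜) {i j : ℤ} (hij : i ≠ j) {m : M.carrier}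
    (h : m ∈ M.deg j) : M.component i m = 0 :=
  DirectSum.decompose_of_mem_ne _ h hij.symm

lemma exists_sum_component (M : GrProj 𝒜) (m : M.carrier) :
    ∃ s : Finset ℤ, ∀ t, s ⊆ t → ∑ i ∈ t, M.component i m = m := by
  classical
  refine ⟨(DirectSum.decompose M.deg m).support, fun t ht => ?_⟩
  conv_rhs => rw [← DirectSum.sum_support_decompose M.deg m]
  refine (Finset.sum_subset ht fun i _ hi => ?_).symm
  rw [DFinsupp.notMem_support_iff] at hi
  rw [component_apply, hi]
  rfl

/-- The direct sum of finitely many graded projective modules. -/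
def pi {n : ℕ} (M : Fin n → GrProj 𝒜) : GrProj 𝒜 where
  carrier := ∀ k, (M k).carrier
  projective := Module.Projective.of_equiv (DFinsupp.linearEquivFunOnFintype (R := A))
  deg i := AddSubgroup.pi Set.univ fun k => (M k).deg i
  isInternal := by
    classical
    refine isInternal_of_projections _
      (fun i => AddMonoidHom.mk' (fun f k => (M k).component i (f k)) fun f g => by
        ext k
        simp) ?_ ?_ ?_ ?_
    · intro i f k _
      exact (M k).component_mem i (f k)
    · intro i f hf
      ext k
      exact (M k).component_of_mem (hf k trivial)
    · intro i j hij f hf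
      ext k
      exact (M k).component_of_mem_ne hij (hf k trivial)
    · intro f
      choose s hs using fun k => (M k).exists_sum_component (f k)
      refine ⟨Finset.univ.biUnion s, ?_⟩
      ext k
      rw [Finset.sum_apply]
      exact hs k _ (Finset.subset_biUnion_of_mem s (Finset.mem_univ k))
  smul_mem := by
    intro i j x m hx hm k _
    exact (M k).smul_mem hx (hm k trivial)

end GrProj

/-- The class of a graded projective module in the split Grothendieck group. -/
def K0.mk (M : GrProj 𝒜) : K0 𝒜 := Submodule.Quotient.mk (Finsupp.single M 1)

namespace K0

lemma mk_of_isDirectSum {M M₁ M₂ : GrProj 𝒜} (h : M.IsDirectSum M₁ M₂) :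
    mk M = mk M₁ + mk M₂ := by
  rw [mk, mk, mk, ← Submodule.Quotient.mk_add, Submodule.Quotient.eq]
  exact Submodule.subset_span (Or.inl ⟨M, M₁, M₂, h, rfl⟩)

lemma mk_shift (M : GrProj 𝒜) (t : ℤ) :
    mk (M.shift t) = (LaurentPolynomial.T t : LaurentPolynomial ℤ) • mk M := by
  rw [mk, mk, ← Submodule.Quotient.mk_smul, Submodule.Quotient.eq, Finsupp.smul_single,
    smul_eq_mul, mul_one]
  exact Submodule.subset_span (Or.inr ⟨M, t, rfl⟩)

lemma span_range_mk : Submodule.span (LaurentPolynomial ℤ) (Set.range (mk (𝒜 := 𝒜))) = ⊤ := by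
  rw [eq_top_iff]
  rintro x -
  obtain ⟨z, rfl⟩ := Submodule.Quotient.mk_surjective _ x
  induction z using Finsupp.induction_linear with
  | zero => exact zero_mem _
  | add f g hf hg =>
    rw [Submodule.Quotient.mk_add]
    exact add_mem hf hg
  | single M c =>
    have e : (Submodule.Quotient.mk (Finsupp.single M c) : K0 𝒜) = c • mk M := by
      rw [mk, ← Submodule.Quotient.mk_smul, Finsupp.smul_single, smul_eq_mul, mul_one]
    rw [e]
    exact Submodule.smul_mem _ _ (Submodule.subset_span ⟨M, rfl⟩)

/-- A zero module satisfies M ≅ M ⊕ M, so [M] = 2[M]. -/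
lemma mk_of_subsingleton (M : GrProj 𝒜) [Subsingleton M.carrier] : mk M = 0 := by
  have h : M.IsDirectSum M M :=
    ⟨⟨0, 0, fun _ => Subsingleton.elim _ _, fun _ => Subsingleton.elim _ _⟩, fun i m => by
      simp [Subsingleton.elim m 0, zero_mem]⟩
  simpa using mk_of_isDirectSum h

lemma mk_of_equiv {M M' : GrProj 𝒜} (f : M.carrier ≃ₗ[A] M'.carrier)
    (hf : ∀ i m, m ∈ M.deg i ↔ f m ∈ M'.deg i) : mk M = mk M' := by
  -- The empty direct sum serves as the zero module in M ≅ M' ⊕ 0.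
  let Z : GrProj 𝒜 := GrProj.pi (Fin.elim0 : Fin 0 → GrProj 𝒜)
  have : Subsingleton Z.carrier := inferInstanceAs (Subsingleton (∀ k : Fin 0, _))
  let : Unique Z.carrier := ⟨⟨0⟩, fun _ => Subsingleton.elim _ _⟩
  have h : M.IsDirectSum M' Z := by
    refine ⟨f.trans LinearEquiv.prodUnique.symm, fun i m => ?_⟩
    rw [hf]
    exact (and_iff_left (zero_mem (Z.deg i))).symm
  rw [mk_of_isDirectSum h, mk_of_subsingleton Z, add_zero]

lemma mk_pi {n : ℕ} (M : Fin n → GrProj 𝒜) : mk (GrProj.pi M) = ∑ k, mk (M k) := by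
  induction n with
  | zero =>
    have : Subsingleton (GrProj.pi M).carrier := inferInstanceAs (Subsingleton (∀ k : Fin 0, _))
    rw [mk_of_subsingleton, Finset.univ_eq_empty, Finset.sum_empty]
  | succ n ih =>
    have h : (GrProj.pi M).IsDirectSum (M 0) (GrProj.pi fun k : Fin n => M k.succ) := by
      refine ⟨(Fin.consLinearEquiv A fun k => (M k).carrier).symm, fun i m => ?_⟩
      change (∀ k, _ → _) ↔ _ ∧ ∀ k, _ → _
      simp only [Set.mem_univ, true_imp_iff]
      exact Fin.forall_fin_succ
    rw [mk_of_isDirectSum h, ih, Fin.sum_univ_succ]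

end K0

end Grothendieck

/-! ### Graded projectives over an algebra with a connected full idempotent. -/

section Connected

variable {A : Type} [Ring A] [Algebra ℚ A] {𝒜 : ℤ → Submodule ℚ A} [GradedAlgebra 𝒜] {e : A}

/-- The left ideal `A e` of an idempotent `e`, as the kernel of right multiplication by `1 - e`. -/
def column (e : A) : Submodule A A where
  carrier := {x | x * e = x}
  add_mem' {x y} hx hy := by
    change (x + y) * e = x + y
    rw [add_mul, hx, hy]
  zero_mem' := zero_mul e
  smul_mem' c x hx := by
    change c * x * e = c * x
    rw [mul_assoc, hx]

omit [Algebra ℚ A] in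
lemma mem_column {x : A} : x ∈ column e ↔ x * e = x := Iff.rfl

/-- Right multiplication by an idempotent, as a projection onto its column. -/
def toColumn (he : IsIdempotentElem e) : A →ₗ[A] column e where
  toFun x := ⟨x * e, by rw [mem_column, mul_assoc, he.eq]⟩
  map_add' x y := Subtype.ext (add_mul x y e)
  map_smul' c x := Subtype.ext (mul_assoc c x e)

omit [Algebra ℚ A] in
lemma toColumn_of_mem (he : IsIdempotentElem e) (x : column e) : toColumn he x = x :=
  Subtype.ext x.2

lemma proj_mul_of_mem (he : e ∈ 𝒜 0) (i : ℤ) (x : A) :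
    (DirectSum.decompose 𝒜 (x * e) i : A) = DirectSum.decompose 𝒜 x i * e := by
  have := DirectSum.coe_decompose_mul_add_of_right_mem 𝒜 (a := x) (i := i) he
  rwa [add_zero] at this

/-- The graded projective module `A e`. -/
def columnModule (h : IsConnectedFullIdempotent 𝒜 e) : GrProj 𝒜 where
  carrier := column e
  finite := Module.Finite.of_surjective (toColumn h.idem) fun x => ⟨x, toColumn_of_mem h.idem x⟩
  projective := Module.Projective.of_split (column e).subtype (toColumn h.idem)
    (LinearMap.ext (toColumn_of_mem h.idem))
  deg i := (𝒜 i).toAddSubgroup.comap (column e).subtype.toAddMonoidHom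
  isInternal := by
    classical
    refine isInternal_of_projections _ (fun i => AddMonoidHom.mk' (fun x : column e =>
      (⟨DirectSum.decompose 𝒜 (x : A) i, by
        rw [mem_column, ← proj_mul_of_mem h.mem, x.2]⟩ : column e)) fun x y => by
          ext
          simp) ?_ ?_ ?_ ?_
    · intro i x
      exact (DirectSum.decompose 𝒜 (x : A) i).2
    · intro i x hx
      exact Subtype.ext (DirectSum.decompose_of_mem_same 𝒜 hx)
    · intro i j hij x hx
      exact Subtype.ext (DirectSum.decompose_of_mem_ne 𝒜 hx hij.symm)
    · intro x
      refine ⟨(DirectSum.decompose 𝒜 (x : A)).support, Subtype.ext ?_⟩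
      conv_rhs => rw [← DirectSum.sum_support_decompose 𝒜 (x : A)]
      simp
  smul_mem hx hm := SetLike.GradedMul.mul_mem hx hm

/-- The span of the homogeneous elements of positive degree in `e A e`. -/
def cornerRadical (𝒜 : ℤ → Submodule ℚ A) (e : A) : Submodule ℚ A :=
  Submodule.span ℚ {y | ∃ i, 0 < i ∧ ∃ x ∈ 𝒜 i, y = e * x * e}

omit [GradedAlgebra 𝒜] in
lemma cornerRadical_mul (he : IsIdempotentElem e) {r : A} (hr : r ∈ cornerRadical 𝒜 e) :
    r * e = r := by
  induction hr using Submodule.span_induction with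
  | mem x hx =>
    obtain ⟨i, _, x, _, rfl⟩ := hx
    rw [mul_assoc, he.eq]
  | zero => exact zero_mul e
  | add x y _ _ hx hy => rw [add_mul, hx, hy]
  | smul c x _ hx => rw [smul_mul_assoc, hx]

/-- The corner eAe is ℚe plus its positive part, which plays the role of the maximal ideal. -/
lemma exists_corner_eq (h : IsConnectedFullIdempotent 𝒜 e) (x : A) :
    ∃ c : ℚ, ∃ r ∈ cornerRadical 𝒜 e, e * x * e = c • e + r := by
  induction x using DirectSum.Decomposition.inductionOn 𝒜 with
  | zero => exact ⟨0, 0, zero_mem _, by simp⟩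
  | @homogeneous i x =>
    rcases lt_trichotomy i 0 with hi | rfl | hi
    · exact ⟨0, 0, zero_mem _, by rw [h.corner_neg i hi x x.2]; simp⟩
    · obtain ⟨c, hc⟩ := h.corner_zero x x.2
      exact ⟨c, 0, zero_mem _, by rw [hc, add_zero]⟩
    · exact ⟨0, _, Submodule.subset_span ⟨i, hi, x, x.2, rfl⟩, by simp⟩
  | add x y hx hy =>
    obtain ⟨c, r, hr, hc⟩ := hx
    obtain ⟨c', r', hr', hc'⟩ := hy
    refine ⟨c + c', r + r', add_mem hr hr', ?_⟩
    rw [mul_add, add_mul, hc, hc', add_smul]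
    abel

lemma finite_grading_ne_bot [FiniteDimensional ℚ A] : {i | 𝒜 i ≠ ⊥}.Finite :=
  WellFoundedGT.finite_ne_bot_of_iSupIndep
    (DirectSum.Decomposition.isInternal 𝒜).submodule_iSupIndep

/-- The n-th power sits in degrees at least n, and a finite-dimensional algebra has only finitely
many nonzero degrees. -/
lemma exists_cornerRadical_pow_eq_bot [FiniteDimensional ℚ A]
    (h : IsConnectedFullIdempotent 𝒜 e) : ∃ n, cornerRadical 𝒜 e ^ n = ⊥ := by
  obtain ⟨b, hb⟩ := (finite_grading_ne_bot (𝒜 := 𝒜)).bddAbove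
  have hle : ∀ n : ℕ, cornerRadical 𝒜 e ^ n ≤
      Submodule.span ℚ {y | ∃ i : ℤ, (n : ℤ) ≤ i ∧ y ∈ 𝒜 i} := by
    intro n
    induction n with
    | zero =>
      rw [pow_zero, Submodule.one_le]
      exact Submodule.subset_span ⟨0, le_rfl, SetLike.GradedOne.one_mem⟩
    | succ n ih =>
      rw [pow_succ]
      refine (mul_le_mul' ih le_rfl).trans ?_
      rw [cornerRadical, Submodule.span_mul_span]
      refine Submodule.span_mono ?_
      rintro _ ⟨y, ⟨i, hi, hy⟩, _, ⟨j, hj, x, hx, rfl⟩, rfl⟩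
      refine ⟨i + (0 + j + 0), by push_cast; omega, ?_⟩
      exact SetLike.GradedMul.mul_mem hy
        (SetLike.GradedMul.mul_mem (SetLike.GradedMul.mul_mem h.mem hx) h.mem)
  refine ⟨(b + 1).toNat, eq_bot_iff.2 ((hle _).trans ?_)⟩
  rw [Submodule.span_le]
  rintro y ⟨i, hi, hy⟩
  by_contra hne
  have : 𝒜 i ≠ ⊥ := fun h0 => hne (by rwa [h0] at hy)
  have := hb this
  omega

/-! ### Nakayama's lemma for modules tested on their corner eX. -/

section Nakayama

variable {X : Type*} [AddCommGroup X] [Module A X] [Module ℚ X] [IsScalarTower ℚ A X]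

/-- The subspace `e X` of a module. -/
def corner (X : Type*) [AddCommGroup X] [Module A X] [Module ℚ X] [IsScalarTower ℚ A X] (e : A) :
    Submodule ℚ X :=
  LinearMap.range (Algebra.lsmul ℚ ℚ X e)

lemma mem_corner {x : X} : x ∈ corner X e ↔ ∃ y, e • y = x := Iff.rfl

omit [GradedAlgebra 𝒜] in
-- The annihilator of X is a two-sided ideal containing the full idempotent `e`, hence 1.
lemma eq_zero_of_corner_eq_bot (h : IsConnectedFullIdempotent 𝒜 e) (hX : corner X e = ⊥) (x : X) :
    x = 0 := by
  let I : TwoSidedIdeal A := TwoSidedIdeal.mk' {a | ∀ x : X, a • x = 0}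
    (fun x => zero_smul A x)
    (fun ha hb x => by rw [add_smul, ha x, hb x, add_zero])
    (fun ha x => by rw [neg_smul, ha x, neg_zero])
    (fun hb x => by rw [mul_smul, hb x, smul_zero])
    (fun ha x => by rw [mul_smul, ha])
  have h1 : (1 : A) ∈ I := h.full I ((TwoSidedIdeal.mem_mk' ..).2 fun x =>
    (Submodule.mem_bot ℚ).1 (hX ▸ mem_corner.2 ⟨x, rfl⟩))
  simpa using (TwoSidedIdeal.mem_mk' ..).1 h1 x

lemma eq_zero_of_corner_le [FiniteDimensional ℚ A] (h : IsConnectedFullIdempotent 𝒜 e)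
    (hX : corner X e ≤ cornerRadical 𝒜 e • corner X e) (x : X) : x = 0 := by
  obtain ⟨n, hn⟩ := exists_cornerRadical_pow_eq_bot h
  refine eq_zero_of_corner_eq_bot h (eq_bot_iff.2 ?_) x
  have : ∀ n, corner X e ≤ cornerRadical 𝒜 e ^ n • corner X e := by
    intro n
    induction n with
    | zero => rw [pow_zero, Submodule.one_smul]
    | succ n ih =>
      rw [pow_succ]
      refine ih.trans ((Submodule.smul_mono le_rfl hX).trans ?_)
      exact (Submodule.smul_assoc (cornerRadical 𝒜 e ^ n) (cornerRadical 𝒜 e) (corner X e)).ge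
  exact (this n).trans (by rw [hn, Submodule.bot_smul])

/-- The map from a sum of copies of `A e` given by a family of elements. -/
def columnsMap {n : ℕ} (m : Fin n → X) : (Fin n → column e) →ₗ[A] X where
  toFun x := ∑ k, (x k : A) • m k
  map_add' x y := by simp [add_smul, Finset.sum_add_distrib]
  map_smul' c x := by simp [mul_smul, Finset.smul_sum]

omit [Algebra ℚ A] [Module ℚ X] [IsScalarTower ℚ A X] in
lemma columnsMap_apply {n : ℕ} (m : Fin n → X) (x : Fin n → column e) :
    columnsMap m x = ∑ k, (x k : A) • m k := rfl

/-- Nakayama is applied to the cokernel, where the images of the `m k` vanish. -/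
lemma columnsMap_surjective [FiniteDimensional ℚ A] (h : IsConnectedFullIdempotent 𝒜 e) {n : ℕ}
    {m : Fin n → X} (hm : ∀ k, e • m k = m k)
    (hspan : corner X e ≤ Submodule.span ℚ (Set.range m) ⊔ cornerRadical 𝒜 e • corner X e) :
    Function.Surjective (columnsMap (e := e) m) := by
  rw [← LinearMap.range_eq_top, ← Submodule.Quotient.subsingleton_iff]
  set R := LinearMap.range (columnsMap (e := e) m)
  have hmem : ∀ k, m k ∈ R := fun k => by
    refine ⟨Pi.single k ⟨e, h.idem⟩, ?_⟩
    rw [columnsMap_apply, Finset.sum_eq_single k, Pi.single_eq_same, hm]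
    · intro j _ hj
      rw [Pi.single_eq_of_ne hj, Submodule.coe_zero, zero_smul]
    · simp
  let π : X →ₗ[ℚ] X ⧸ R := R.mkQ.restrictScalars ℚ
  have hle : Submodule.span ℚ (Set.range m) ⊔ cornerRadical 𝒜 e • corner X e ≤
      (cornerRadical 𝒜 e • corner (X ⧸ R) e).comap π := by
    refine sup_le (Submodule.span_le.2 ?_) (Submodule.smul_le.2 ?_)
    · rintro _ ⟨k, rfl⟩
      have : π (m k) = 0 := (Submodule.Quotient.mk_eq_zero R).2 (hmem k)
      rw [SetLike.mem_coe, Submodule.mem_comap, this]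
      exact zero_mem _
    · rintro r hr _ ⟨y, rfl⟩
      exact Submodule.smul_mem_smul hr (mem_corner.2 ⟨π y, rfl⟩)
  refine subsingleton_of_forall_eq 0 (eq_zero_of_corner_le h ?_)
  rintro _ ⟨z, rfl⟩
  obtain ⟨y, rfl⟩ := Submodule.Quotient.mk_surjective R z
  exact hle (hspan (mem_corner.2 ⟨y, rfl⟩))

/-- Projectivity of X splits the map, so its kernel is a direct summand. Independence modulo the
radical puts e·ker inside rad · e(Ae)^n; the projection `p` onto the kernel carries this into rad ·
e·ker, and Nakayama applies. -/
lemma columnsMap_injective [FiniteDimensional ℚ A] [Module.Projective A X]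
    (h : IsConnectedFullIdempotent 𝒜 e) {n : ℕ} {m : Fin n → X} (hm : ∀ k, e • m k = m k)
    (hli : LinearIndependent ℚ fun k => (cornerRadical 𝒜 e • corner X e).mkQ (m k))
    (hsurj : Function.Surjective (columnsMap (e := e) m)) :
    Function.Injective (columnsMap (e := e) m) := by
  set f := columnsMap (e := e) m
  obtain ⟨g, hg⟩ := Module.projective_lifting_property f LinearMap.id hsurj
  rw [← LinearMap.ker_eq_bot, ← Submodule.subsingleton_iff_eq_bot]
  refine subsingleton_of_forall_eq 0 (eq_zero_of_corner_le h ?_)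
  have hfg : ∀ y, f (g y) = y := fun y => DFunLike.congr_fun hg y
  let p : (Fin n → column e) →ₗ[A] LinearMap.ker f :=
    (LinearMap.id - g ∘ₗ f).codRestrict _ fun x => by
      rw [LinearMap.mem_ker, LinearMap.sub_apply, map_sub, LinearMap.comp_apply, hfg,
        LinearMap.id_apply, sub_self]
  have hp : ∀ x : LinearMap.ker f, p x = x := fun x => Subtype.ext <| by
    simp [p, LinearMap.mem_ker.1 x.2]
  rintro _ ⟨x, rfl⟩
  change e • x ∈ _
  choose c r hr hc using fun k => exists_corner_eq h ((x : Fin n → column e) k : A)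
  have hxk : ∀ k, e * ((x : Fin n → column e) k : A) = c k • e + r k := fun k => by
    rw [← hc, mul_assoc, ((x : Fin n → column e) k).2]
  have hf : f (e • (x : Fin n → column e)) = 0 := by rw [map_smul, LinearMap.mem_ker.1 x.2, smul_zero]
  have hc0 : ∀ k, c k = 0 := by
    refine Fintype.linearIndependent_iff.1 hli c ?_
    rw [← map_zero (cornerRadical 𝒜 e • corner X e).mkQ, ← hf, columnsMap_apply]
    simp only [← map_smul, ← map_sum]
    rw [← sub_eq_zero, ← map_sub, ← Finset.sum_sub_distrib, Submodule.mkQ_apply,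
      Submodule.Quotient.mk_eq_zero]
    refine Submodule.sum_mem _ fun k _ => ?_
    rw [Pi.smul_apply, Submodule.coe_smul, smul_eq_mul, hxk, add_smul, smul_assoc, hm,
      sub_add_cancel_left]
    exact neg_mem (Submodule.smul_mem_smul (hr k) (mem_corner.2 ⟨m k, hm k⟩))
  have hx : e • (x : Fin n → column e) =
      ∑ k, r k • (e • (Pi.single k ⟨e, h.idem⟩ : Fin n → column e)) := by
    ext j
    rw [Finset.sum_apply, Finset.sum_eq_single j, Pi.smul_apply, Pi.smul_apply, Pi.smul_apply,
      Pi.single_eq_same]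
    · change e * _ = r j * (e * e)
      rw [hxk, hc0, zero_smul, zero_add, h.idem.eq, cornerRadical_mul h.idem (hr j)]
    · intro k _ hk
      simp [Pi.single_eq_of_ne hk.symm]
    · simp
  rw [← hp (e • x), Submodule.coe_smul, hx, map_sum]
  refine Submodule.sum_mem _ fun k _ => ?_
  rw [map_smul, map_smul]
  exact Submodule.smul_mem_smul (hr k) (mem_corner.2 ⟨_, rfl⟩)

end Nakayama

/-- Every graded finitely generated projective module is a direct sum of shifts of `A e`. -/
theorem K0.exists_mk_eq [FiniteDimensional ℚ A] (h : IsConnectedFullIdempotent 𝒜 e)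
    (M : GrProj 𝒜) : ∃ (n : ℕ) (t : Fin n → ℤ),
      K0.mk M = K0.mk (GrProj.pi fun k => (columnModule h).shift (t k)) := by
  let : Module ℚ M.carrier := Module.compHom M.carrier (algebraMap ℚ A)
  have : IsScalarTower ℚ A M.carrier := IsScalarTower.rat
  have : Module.Finite ℚ M.carrier := Module.Finite.trans A M.carrier
  set U := cornerRadical 𝒜 e • corner M.carrier e
  set S : Set M.carrier := {m | e • m = m ∧ ∃ i, m ∈ M.deg i} with hS
  have hES : corner M.carrier e ≤ Submodule.span ℚ S := by
    rintro _ ⟨m, rfl⟩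
    obtain ⟨s, hs⟩ := M.exists_sum_component m
    rw [← hs s le_rfl, map_sum]
    refine Submodule.sum_mem _ fun i _ => Submodule.subset_span ⟨?_, i, ?_⟩
    · change e • (e • M.component i m) = e • M.component i m
      rw [← mul_smul, h.idem.eq]
    · have := M.smul_mem h.mem (M.component_mem i m)
      rwa [zero_add] at this
  -- A basis of the image of eM modulo the radical part U, chosen among images of homogeneous
  -- elements; the degrees of the lifts `m k` are the shifts `t k`.
  obtain ⟨b, hbS, hspan, hli⟩ := exists_linearIndependent ℚ (U.mkQ '' S)
  have : Finite b := hli.finite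
  obtain ⟨n, ⟨φ⟩⟩ := Finite.exists_equiv_fin b
  choose m hmS hm using fun k => hbS (φ.symm k).2
  choose hme t ht using hmS
  have hli' : LinearIndependent ℚ fun k => U.mkQ (m k) := by
    simp only [hm]
    exact hli.comp _ φ.symm.injective
  have hspan' : corner M.carrier e ≤ Submodule.span ℚ (Set.range m) ⊔ U := by
    refine hES.trans (Submodule.span_le.2 fun y hy => ?_)
    have h1 : U.mkQ y ∈ Submodule.span ℚ b := hspan ▸ Submodule.subset_span ⟨y, hy, rfl⟩
    have h2 : b ⊆ U.mkQ '' Set.range m := fun z hz => by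
      refine ⟨_, ⟨φ ⟨z, hz⟩, rfl⟩, ?_⟩
      rw [hm, Equiv.symm_apply_apply]
    have h3 := Submodule.span_mono h2 h1
    rw [Submodule.span_image] at h3
    obtain ⟨w, hw, hwy⟩ := h3
    have h4 : y - w ∈ U := (Submodule.Quotient.eq U).1 hwy.symm
    rw [← add_sub_cancel w y]
    exact Submodule.add_mem_sup hw h4
  have hsurj := columnsMap_surjective h hme hspan'
  have hinj := columnsMap_injective h hme hli' hsurj
  let F := GrProj.pi fun k => (columnModule h).shift (t k)
  let f : F.carrier ≃ₗ[A] M.carrier := LinearEquiv.ofBijective (columnsMap m) ⟨hinj, hsurj⟩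
  have hfdeg : ∀ i x, x ∈ F.deg i → f x ∈ M.deg i := by
    intro i x hx
    have hfx : f x = ∑ k, ((show Fin n → column e from x) k : A) • m k := rfl
    rw [hfx]
    refine sum_mem fun k _ => ?_
    have h1 := M.smul_mem (hx k trivial) (ht k)
    rwa [sub_add_cancel] at h1
  refine ⟨n, t, (K0.mk_of_equiv f fun i x => ⟨hfdeg i x, fun hx => ?_⟩).symm⟩
  -- That `f` maps degree i into degree i is known; commuting with homogeneous components gives the
  -- converse, that degrees are reflected.
  have hcomm : ∀ j, f (F.component j x) = M.component j (f x) := by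
    intro j
    obtain ⟨s, hs⟩ := F.exists_sum_component x
    have hs' := hs (insert j s) (Finset.subset_insert j s)
    conv_rhs => rw [← hs', map_sum, map_sum]
    rw [Finset.sum_eq_single j]
    · rw [M.component_of_mem (hfdeg j _ (F.component_mem j x))]
    · intro k _ hk
      exact M.component_of_mem_ne hk.symm (hfdeg k _ (F.component_mem k x))
    · simp
  have : F.component i x = x := f.injective (by rw [hcomm, M.component_of_mem hx])
  rw [← this]
  exact F.component_mem i x

end Connected

/-! ### Graded dimension -/

section GradedDimension

variable {A : Type} [Ring A] [Algebra ℚ A] {𝒜 : ℤ → Submodule ℚ A} [GradedAlgebra 𝒜]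

namespace GrProj

/-- The underlying rational vector space of a graded module. -/
@[reducible]
def moduleRat (M : GrProj 𝒜) : Module ℚ M.carrier := Module.compHom M.carrier (algebraMap ℚ A)

attribute [local instance] moduleRat

/-- The homogeneous part of degree `i`, as a rational vector space. -/
def degRat (M : GrProj 𝒜) (i : ℤ) : Submodule ℚ M.carrier where
  __ := M.deg i
  smul_mem' c m hm := by
    have h := M.smul_mem (SetLike.algebraMap_mem_graded 𝒜 c) hm
    rwa [zero_add] at h

/-- The dimension of the homogeneous part of degree `i`. -/
def dim (M : GrProj 𝒜) (i : ℤ) : ℕ := Module.finrank ℚ (M.degRat i)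

omit [GradedAlgebra 𝒜] in
lemma finite_rat [FiniteDimensional ℚ A] (M : GrProj 𝒜) : FiniteDimensional ℚ M.carrier :=
  have : IsScalarTower ℚ A M.carrier := IsScalarTower.rat
  Module.Finite.trans A M.carrier

lemma isInternal_degRat (M : GrProj 𝒜) : DirectSum.IsInternal M.degRat := M.isInternal

lemma finite_support_dim [FiniteDimensional ℚ A] (M : GrProj 𝒜) :
    (Function.support M.dim).Finite := by
  have := M.finite_rat
  refine (WellFoundedGT.finite_ne_bot_of_iSupIndep
    M.isInternal_degRat.submodule_iSupIndep).subset fun i hi h => hi ?_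
  rw [dim, h, finrank_bot]

lemma dim_of_isDirectSum [FiniteDimensional ℚ A] {M M₁ M₂ : GrProj 𝒜} (h : M.IsDirectSum M₁ M₂)
    (i : ℤ) : M.dim i = M₁.dim i + M₂.dim i := by
  have := M₁.finite_rat
  have := M₂.finite_rat
  obtain ⟨f, hf⟩ := h
  let g : M.degRat i ≃ₗ[ℚ] M₁.degRat i × M₂.degRat i :=
    { toFun m := (⟨(f m).1, ((hf i m).1 m.2).1⟩, ⟨(f m).2, ((hf i m).1 m.2).2⟩)
      invFun p := ⟨f.symm (p.1, p.2), (hf i _).2 (by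
        rw [f.apply_symm_apply]
        exact ⟨p.1.2, p.2.2⟩)⟩
      map_add' m m' := by
        ext <;> simp
      map_smul' c m := by
        have h := f.map_smul (algebraMap ℚ A c) m
        exact Prod.ext (Subtype.ext (congrArg Prod.fst h)) (Subtype.ext (congrArg Prod.snd h))
      left_inv m := by simp
      right_inv p := by simp }
  rw [dim, g.finrank_eq, Module.finrank_prod, dim, dim]

lemma dim_shift (M : GrProj 𝒜) (t i : ℤ) : (M.shift t).dim i = M.dim (i - t) := rfl

/-- The graded dimension of a graded module. -/
def gdim (M : GrProj 𝒜) : LaurentPolynomial ℤ :=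
  ∑ᶠ i, (M.dim i : LaurentPolynomial ℤ) * LaurentPolynomial.T i

lemma finite_support_gdim [FiniteDimensional ℚ A] (M : GrProj 𝒜) :
    (Function.support fun i => (M.dim i : LaurentPolynomial ℤ) * LaurentPolynomial.T i).Finite := by
  refine M.finite_support_dim.subset fun i hi h => hi ?_
  simp only [h, Nat.cast_zero, zero_mul]

lemma gdim_of_isDirectSum [FiniteDimensional ℚ A] {M M₁ M₂ : GrProj 𝒜}
    (h : M.IsDirectSum M₁ M₂) : M.gdim = M₁.gdim + M₂.gdim := by
  rw [gdim, gdim, gdim, ← finsum_add_distrib M₁.finite_support_gdim M₂.finite_support_gdim]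
  refine finsum_congr fun i => ?_
  rw [dim_of_isDirectSum h, Nat.cast_add, add_mul]

lemma gdim_shift [FiniteDimensional ℚ A] (M : GrProj 𝒜) (t : ℤ) :
    (M.shift t).gdim = LaurentPolynomial.T t * M.gdim := by
  rw [gdim, gdim, mul_finsum' _ _ M.finite_support_gdim, ← finsum_comp_equiv (Equiv.addRight t)]
  refine finsum_congr fun i => ?_
  rw [dim_shift, Equiv.coe_addRight, add_sub_cancel_right, LaurentPolynomial.T_add]
  ring

/-- Evaluation at q = 1 turns the graded dimension into the total dimension, which is positive. -/
lemma gdim_ne_zero [FiniteDimensional ℚ A] (M : GrProj 𝒜) {i : ℤ} {m : M.carrier}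
    (hm : m ∈ M.deg i) (h : m ≠ 0) : M.gdim ≠ 0 := by
  have := M.finite_rat
  have hpos : 0 < M.dim i := by
    rw [dim, Module.finrank_pos_iff]
    exact ⟨⟨⟨m, hm⟩, 0, fun h' => h (congrArg Subtype.val h')⟩⟩
  let φ : LaurentPolynomial ℤ →+* ℤ := LaurentPolynomial.eval₂ (RingHom.id ℤ) 1
  have hφ : φ M.gdim = ∑ᶠ i, (M.dim i : ℤ) := by
    rw [gdim]
    refine (AddMonoidHom.map_finsum φ.toAddMonoidHom M.finite_support_gdim).trans
      (finsum_congr fun i => ?_)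
    simp [φ]
  intro h0
  rw [h0, map_zero] at hφ
  have hfin : (Function.support fun i => (M.dim i : ℤ)).Finite :=
    M.finite_support_dim.subset fun i hi h => hi (by simp only [h, Nat.cast_zero])
  have := single_le_finsum i hfin fun j => Int.natCast_nonneg _
  omega

end GrProj

/-- The graded dimension as a linear map on the split Grothendieck group. -/
def K0.gdim [FiniteDimensional ℚ A] : K0 𝒜 →ₗ[LaurentPolynomial ℤ] LaurentPolynomial ℤ :=
  Submodule.liftQ _ (Finsupp.linearCombination _ GrProj.gdim) (by
    rw [Submodule.span_le]
    rintro _ (⟨M, M₁, M₂, h, rfl⟩ | ⟨M, t, rfl⟩)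
    · simp [GrProj.gdim_of_isDirectSum h]
    · simp [GrProj.gdim_shift])

lemma K0.gdim_mk [FiniteDimensional ℚ A] (M : GrProj 𝒜) : K0.gdim (K0.mk M) = M.gdim := by
  simp [K0.gdim, K0.mk]

/-- If `A` is not zero, then `K₀` is free of rank one on the class of `A e`. -/
theorem K0.nonempty_basis [FiniteDimensional ℚ A] [Nontrivial A] {e : A}
    (h : IsConnectedFullIdempotent 𝒜 e) :
    Nonempty (Module.Basis Unit (LaurentPolynomial ℤ) (K0 𝒜)) := by
  have he : e ≠ 0 := fun h0 =>
    one_ne_zero ((TwoSidedIdeal.mem_bot _).1 (h.full ⊥ (h0 ▸ zero_mem _)))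
  have hne : (columnModule h).gdim ≠ 0 :=
    (columnModule h).gdim_ne_zero (m := ⟨e, h.idem⟩) h.mem fun h0 => he (congrArg Subtype.val h0)
  let f := LinearMap.toSpanSingleton (LaurentPolynomial ℤ) (K0 𝒜) (K0.mk (columnModule h))
  -- If c[Ae] = 0, taking graded dimensions gives c · gdim(Ae) = 0 in the domain ℤ[q, q⁻¹].
  have hinj : Function.Injective f := by
    refine (injective_iff_map_eq_zero _).2 fun c hc => ?_
    have h1 := congrArg K0.gdim hc
    rw [LinearMap.toSpanSingleton_apply, map_smul, K0.gdim_mk, map_zero, smul_eq_mul] at h1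
    exact (mul_eq_zero.1 h1).resolve_right hne
  have hsurj : Function.Surjective f := by
    rw [← LinearMap.range_eq_top, eq_top_iff, ← K0.span_range_mk, Submodule.span_le]
    rintro _ ⟨M, rfl⟩
    obtain ⟨n, t, hM⟩ := K0.exists_mk_eq h M
    rw [hM, K0.mk_pi]
    refine Submodule.sum_mem _ fun k _ => ?_
    rw [K0.mk_shift]
    exact ⟨_, rfl⟩
  exact ⟨(Module.Basis.singleton Unit (LaurentPolynomial ℤ)).map
    (LinearEquiv.ofBijective f ⟨hinj, hsurj⟩)⟩

omit [GradedAlgebra 𝒜] in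
lemma K0.subsingleton [Subsingleton A] : Subsingleton (K0 𝒜) := by
  rw [← Submodule.subsingleton_iff (LaurentPolynomial ℤ), ← subsingleton_iff_bot_eq_top,
    ← K0.span_range_mk, eq_comm, Submodule.span_eq_bot]
  rintro _ ⟨M, rfl⟩
  have : Subsingleton M.carrier := Module.subsingleton A M.carrier
  exact K0.mk_of_subsingleton M

end GradedDimension

/-- The Grothendieck group of `NH_a^N` has rank one for `a ≤ N` and vanishes otherwise. -/
theorem CycNH.nonempty_basis (a N : ℕ) :
    Nonempty (Module.Basis (PLift (a ≤ N)) (LaurentPolynomial ℤ)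
      (K0 (A := CycNH a N) (CycNH.grading a N))) := by
  by_cases h : a ≤ N
  · have := CycNH.nontrivial h
    have := CycNH.finiteDimensional a N
    obtain ⟨b⟩ := K0.nonempty_basis (CycNH.isConnectedFullIdempotent a N)
    exact ⟨b.reindex ⟨fun _ => ⟨h⟩, fun _ => (), fun _ => rfl, fun _ => rfl⟩⟩
  · have := CycNH.subsingleton_of_lt a N (not_le.1 h)
    have : Subsingleton (K0 (A := CycNH a N) (CycNH.grading a N)) := K0.subsingleton
    have : IsEmpty (PLift (a ≤ N)) := ⟨fun h' => h h'.down⟩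
    exact ⟨Module.Basis.empty _⟩

end CycNilHecke

end

theorem mainTheorem2 (N : ℕ) (hN : 0 < N) :
    Nonempty ((DirectSum ℕ fun a : ℕ =>
        TensorProduct (LaurentPolynomial ℤ) CycNilHecke.Qq
          (CycNilHecke.K0 (A := CycNilHecke.CycNH a N) (CycNilHecke.CycNH.grading a N)))
      ≃ₗ[CycNilHecke.Qq] CycNilHecke.VN N) := by
  let B := DFinsupp.basis fun a =>
    Algebra.TensorProduct.basis CycNilHecke.Qq (CycNilHecke.CycNH.nonempty_basis a N).some
  -- Each summand contributes one basis vector exactly when a ≤ N, so the combined basis is indexed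
  -- by 0, …, N.
  let σ : (Σ a : ℕ, PLift (a ≤ N)) ≃ Fin (N + 1) :=
    { toFun p := ⟨p.1, Nat.lt_succ_of_le p.2.down⟩
      invFun i := ⟨i, ⟨Nat.le_of_lt_succ i.2⟩⟩
      left_inv _ := rfl
      right_inv _ := rfl }
  exact ⟨(B.reindex σ).equivFun⟩
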